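/- Let $q\in\mathbf C^*$ with $|q|>1$, and let $K$ be one of the fields $\mathcal M(\mathbf C)\subset \mathbf C(\{z\})\subset\mathbf C((z))$: the meromorphic functions on $\mathbf C$, the germs at $0$ of meromorphic functions (these two are the "convergent case"), and the formal Laurent series (the "formal case"). Let $v_0$ be the $z$-adic valuation of $K$ and $\sigma_q:f(z)\mapsto f(qz)$. A $q$-difference module over $K$ is a pair $(M,\Phi)$ where $M$ is a finite-dimensional $K$-vector space and $\Phi:M\to M$ is bijective, additive and satisfies $\Phi(\lambda x)=\sigma_q(\lambda)\Phi(x)$. Its rank is $\dim_K M$. A submodule is a $K$-subspace stable under $\Phi$ and $\Phi^{-1}$; submodules and quotients by them are again $q$-difference modules. Fix roots $q_l$ ($l\ge 1$) with $q_1=q$ and $q_{lm}^{\,l}=q_m$. Let $K_l\supset K$ be the field of the same kind in a variable $z_l$ with $z_l^l=z$, with its $z_l$-adic valuation $v$ and the automorphism $\sigma_{q_l}: f(z_l)\mapsto f(q_lz_l)$. The Newton function $r_M:\mathbf Q\to\mathbf N$ of $M$ is defined as follows. For a suitable $l\ge 1$, the module $M_l=K_l\otimes_K M$, with the operator $\sigma_{q_l}\otimes\Phi$,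 has a tower of submodules $0=F_0\subset F_1\subset\dots\subset F_n=M_l$ such that each $F_i/F_{i-1}$ has rank one, with a basis $e_i$ on which the operator acts by $e_i\mapsto a_ie_i$, $a_i\in K_l^*$. Then $r_M(\mu)$ is the number of indices $i$ with $v(a_i)/l=\mu$; this does not depend on the choices. The set of slopes of $M$ is $S(M)=\{\mu\in\mathbf Q : r_M(\mu)\neq 0\}$, and $M$ is called pure of slope $\mu$ if $S(M)=\{\mu\}$. **Theorem.** Let $M$ be a $q$-difference module over $K$ and let $\mu\in S(M)$; in the convergent case, assume moreover that $\mu=\max S(M)$. Then among the submodules of $M$ that are pure of slope $\mu$ there is a largest one, $M^{[\mu]}$ (it contains all the others); its rank is $r_M(\mu)$, and the quotient satisfies $$S(M/M^{[\mu]})=S(M)\setminus\{\mu\}.$$ -/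

import Mathlib

open Filter Topology
open scoped LaurentSeries TensorProduct

namespace QDiff

/-- The formal Laurent series `f` converges on a punctured neighbourhood of `0`, with sum `g`. -/
def HasLaurentExpansion (g : ℂ → ℂ) (f : ℂ⸨X⸩) : Prop :=
  ∀ᶠ z in 𝓝[≠] (0 : ℂ), HasSum (fun n : ℤ => f.coeff n * z ^ n) (g z)

namespace HasLaurentExpansion

theorem hasSum_of_eq {ι : Type*} {u v : ι → ℂ} {s : ℂ} (h : ∀ i, u i = v i) (hv : HasSum v s) :
    HasSum u s := by
  rwa [funext h]

theorem congr {g h : ℂ → ℂ} {f : ℂ⸨X⸩} (hf : HasLaurentExpansion g f)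
    (hgh : g =ᶠ[𝓝[≠] (0 : ℂ)] h) : HasLaurentExpansion h f := by
  filter_upwards [hf, hgh] with z h1 h2
  rwa [← h2]

theorem zero : HasLaurentExpansion 0 0 := by
  refine Eventually.of_forall fun z => ?_
  simp [hasSum_zero]

theorem neg {g : ℂ → ℂ} {f : ℂ⸨X⸩} (hf : HasLaurentExpansion g f) :
    HasLaurentExpansion (-g) (-f) := by
  filter_upwards [hf] with z h
  simpa [neg_mul] using h.neg

theorem add {g₁ g₂ : ℂ → ℂ} {f₁ f₂ : ℂ⸨X⸩} (h₁ : HasLaurentExpansion g₁ f₁)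
    (h₂ : HasLaurentExpansion g₂ f₂) : HasLaurentExpansion (g₁ + g₂) (f₁ + f₂) := by
  filter_upwards [h₁, h₂] with z h h'
  simpa [add_mul] using h.add h'

theorem single (k : ℤ) : HasLaurentExpansion (fun z => z ^ k) (HahnSeries.single k 1) := by
  refine Eventually.of_forall fun z => ?_
  have h := hasSum_ite_eq k (z ^ k)
  have e : (fun n : ℤ => (HahnSeries.single k (1 : ℂ)).coeff n * z ^ n)
      = fun n => if n = k then z ^ k else 0 := by
    funext n
    by_cases hn : n = k
    · subst hn; simp
    · simp [HahnSeries.coeff_single_of_ne hn, hn]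
  rw [e]
  exact h

theorem one : HasLaurentExpansion 1 1 :=
  (single 0).congr (by simp [EventuallyEq])

/-- The bijection `(n, i) ↦ (i, n - i)`. -/
def shear : ℤ × ℤ ≃ ℤ × ℤ where
  toFun p := (p.2, p.1 - p.2)
  invFun p := (p.1 + p.2, p.1)
  left_inv p := by simp
  right_inv p := by simp

theorem hasSum_shear {F : ℤ × ℤ → ℂ} {s : ℂ} {c : ℤ → ℂ} (H : HasSum F s)
    (hc : ∀ n, HasSum (fun i => F (i, n - i)) (c n)) : HasSum c s :=
  (shear.hasSum_iff.mpr H).prod_fiberwise hc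

theorem hasSum_conv (f₁ f₂ : ℂ⸨X⸩) {z : ℂ} (hz : z ≠ 0) (n : ℤ) :
    HasSum (fun i : ℤ => (f₁.coeff i * z ^ i) * (f₂.coeff (n - i) * z ^ (n - i)))
      ((f₁ * f₂).coeff n * z ^ n) := by
  set A := Finset.antidiagonal f₁.isPWO_support f₂.isPWO_support n with hA
  have key : HasSum (fun i : ℤ => (f₁.coeff i * z ^ i) * (f₂.coeff (n - i) * z ^ (n - i)))
      (∑ i ∈ A.image Prod.fst, (f₁.coeff i * z ^ i) * (f₂.coeff (n - i) * z ^ (n - i))) := by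
    refine hasSum_sum_of_ne_finset_zero fun i hi => ?_
    by_contra hne
    refine hi (Finset.mem_image.mpr ⟨(i, n - i), ?_, rfl⟩)
    rw [hA, Finset.mem_antidiagonal]
    refine ⟨fun h0 => hne (by simp [h0]), fun h0 => hne (by simp [h0]), by simp⟩
  have hsum : (∑ i ∈ A.image Prod.fst, (f₁.coeff i * z ^ i) * (f₂.coeff (n - i) * z ^ (n - i)))
      = (f₁ * f₂).coeff n * z ^ n := by
    rw [HahnSeries.coeff_mul, Finset.sum_mul, Finset.sum_image]
    · refine Finset.sum_congr rfl fun p hp => ?_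
      have hp' := (Finset.mem_antidiagonal.mp hp).2.2
      have : n - p.1 = p.2 := by omega
      rw [this, ← hp', zpow_add₀ hz]
      ring
    · intro p hp p' hp' hpp
      have h1 := (Finset.mem_antidiagonal.mp hp).2.2
      have h2 := (Finset.mem_antidiagonal.mp hp').2.2
      ext
      · exact hpp
      · have hpp' : p.1 = p'.1 := hpp
        omega
  rw [← hsum]
  exact key

theorem mul {g₁ g₂ : ℂ → ℂ} {f₁ f₂ : ℂ⸨X⸩} (h₁ : HasLaurentExpansion g₁ f₁)
    (h₂ : HasLaurentExpansion g₂ f₂) : HasLaurentExpansion (g₁ * g₂) (f₁ * f₂) := by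
  filter_upwards [h₁, h₂, self_mem_nhdsWithin] with z h h' hz
  have hs := summable_mul_of_summable_norm h.summable.norm h'.summable.norm
  exact hasSum_shear (h.mul h' hs) (hasSum_conv f₁ f₂ hz)

/-- A convergent Laurent series is, up to a power of `z`, the expansion of an analytic function
whose value at `0` is its leading coefficient. -/
theorem exists_analyticAt {g : ℂ → ℂ} {f : ℂ⸨X⸩} (hf : HasLaurentExpansion g f) :
    ∃ h : ℂ → ℂ, AnalyticAt ℂ h 0 ∧ h 0 = f.coeff f.order ∧
      h =ᶠ[𝓝[≠] (0 : ℂ)] fun z => z ^ (-f.order) * g z := by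
  let p : FormalMultilinearSeries ℂ ℂ ℂ :=
    FormalMultilinearSeries.ofScalars ℂ fun n : ℕ => f.coeff (f.order + n)
  let h : ℂ → ℂ := Function.update (fun z => z ^ (-f.order) * g z) 0 (f.coeff f.order)
  have hz0 : h 0 = f.coeff f.order := Function.update_self ..
  have hne : ∀ z ≠ 0, h z = z ^ (-f.order) * g z := fun z hz => Function.update_of_ne hz ..
  refine ⟨h, ?_, hz0, ?_⟩
  · refine HasFPowerSeriesAt.analyticAt (p := p) (hasFPowerSeriesAt_iff.mpr ?_)
    have hf' := eventually_nhdsWithin_iff.mp hf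
    filter_upwards [hf'] with z hz
    rw [zero_add]
    by_cases h0 : z = 0
    · subst h0
      rw [hz0]
      have := hasSum_single (f := fun n : ℕ => (0 : ℂ) ^ n • p.coeff n) 0 (by
        intro n hn
        simp [hn])
      simpa [p, FormalMultilinearSeries.coeff_ofScalars] using this
    · have hs := (hz h0).mul_left (z ^ (-f.order))
      rw [hne z h0]
      have hinj : Function.Injective fun n : ℕ => f.order + (n : ℤ) := fun a b hab => by
        simpa using hab
      rw [← hinj.hasSum_iff] at hs
      · refine hasSum_of_eq (fun n => ?_) hs
        simp only [p, FormalMultilinearSeries.coeff_ofScalars, Function.comp, smul_eq_mul]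
        rw [zpow_add₀ h0, zpow_neg, zpow_natCast]
        have : z ^ f.order ≠ 0 := zpow_ne_zero _ h0
        field_simp
      · intro n hn
        have : f.coeff n = 0 := by
          refine HahnSeries.coeff_eq_zero_of_lt_order ?_
          by_contra hlt
          exact hn ⟨(n - f.order).toNat, by simp only; omega⟩
        simp [this]
  · filter_upwards [self_mem_nhdsWithin] with z hz using hne z hz

theorem meromorphicAt {g : ℂ → ℂ} {f : ℂ⸨X⸩} (hf : HasLaurentExpansion g f) :
    MeromorphicAt g 0 := by
  obtain ⟨h, ha, -, he⟩ := hf.exists_analyticAt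
  have hm : MeromorphicAt (fun z => z ^ f.order * h z) 0 :=
    ((MeromorphicAt.id 0).zpow f.order).mul ha.meromorphicAt
  refine hm.congr ?_
  filter_upwards [he, self_mem_nhdsWithin] with z hz h0
  have h0 : z ≠ 0 := h0
  rw [hz, ← mul_assoc, ← zpow_add₀ h0]
  simp

theorem eq_zero {g : ℂ → ℂ} {f : ℂ⸨X⸩} (hf : HasLaurentExpansion g f)
    (hg : ∀ᶠ z in 𝓝[≠] (0 : ℂ), g z = 0) : f = 0 := by
  by_contra hne
  obtain ⟨h, ha, h0, he⟩ := hf.exists_analyticAt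
  have h1 : ∀ᶠ z in 𝓝[≠] (0 : ℂ), h z = 0 := by
    filter_upwards [he, hg] with z hz hz'
    rw [hz, hz', mul_zero]
  have h2 := (ha.frequently_zero_iff_eventually_zero.mp h1.frequently).self_of_nhds
  rw [h0] at h2
  exact HahnSeries.coeff_order_eq_zero.not.mpr hne h2

theorem exists_of_meromorphicAt {g : ℂ → ℂ} (hg : MeromorphicAt g 0) :
    ∃ f, HasLaurentExpansion g f := by
  obtain ⟨n, p, hp⟩ := hg
  rw [hasFPowerSeriesAt_iff] at hp
  have h1 : HasLaurentExpansion (fun z => z ^ n * g z)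
      (HahnSeries.ofPowerSeries ℤ ℂ (PowerSeries.mk p.coeff)) := by
    filter_upwards [nhdsWithin_le_nhds hp] with z hz
    have hinj : Function.Injective fun n : ℕ => (n : ℤ) := Nat.cast_injective
    rw [← hinj.hasSum_iff]
    · have hz' : HasSum (fun k => z ^ k • p.coeff k) (z ^ n * g z) := by
        simpa only [zero_add, sub_zero, smul_eq_mul] using hz
      refine hasSum_of_eq (fun k => ?_) hz'
      have := HahnSeries.ofPowerSeries_apply_coeff (Γ := ℤ) (PowerSeries.mk p.coeff) k
      simp only [Function.comp]
      rw [this, smul_eq_mul, PowerSeries.coeff_mk, zpow_natCast, mul_comm]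
    · intro k hk
      rw [HahnSeries.ofPowerSeries_apply, HahnSeries.embDomain_of_notMem_range, zero_mul]
      simpa using hk
  refine ⟨_, ((single (-(n : ℤ))).mul h1).congr ?_⟩
  filter_upwards [self_mem_nhdsWithin] with z h0
  have h0 : z ≠ 0 := h0
  simp [h0]

theorem inv {g : ℂ → ℂ} {f : ℂ⸨X⸩} (hf : HasLaurentExpansion g f) :
    HasLaurentExpansion g⁻¹ f⁻¹ := by
  obtain ⟨f', hf'⟩ := exists_of_meromorphicAt hf.meromorphicAt.inv
  rcases hf.meromorphicAt.eventually_eq_zero_or_eventually_ne_zero with h | h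
  · have h0 := hf.eq_zero h
    have h0' := hf'.eq_zero (h.mono fun z hz => by simp [hz])
    rw [h0, inv_zero]
    rwa [h0'] at hf'
  · have h1 : f * f' + -1 = 0 := by
      refine ((mul hf hf').add one.neg).eq_zero (h.mono fun z hz => ?_)
      simp [hz]
    rw [← eq_inv_of_mul_eq_one_right (add_neg_eq_zero.mp h1)]
    exact hf'


theorem scale {g : ℂ → ℂ} {f f' : ℂ⸨X⸩} {c : ℂ} (hc : c ≠ 0) (hf : HasLaurentExpansion g f)
    (h : ∀ n, f'.coeff n = c ^ n * f.coeff n) : HasLaurentExpansion (fun z => g (c * z)) f' := by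
  have ht : Tendsto (fun z : ℂ => c * z) (𝓝[≠] 0) (𝓝[≠] 0) := by
    refine tendsto_nhdsWithin_iff.mpr ⟨?_, ?_⟩
    · exact ((continuous_const_mul c).tendsto' 0 0 (mul_zero c)).mono_left nhdsWithin_le_nhds
    · filter_upwards [self_mem_nhdsWithin] with z hz using mul_ne_zero hc hz
  filter_upwards [ht.eventually hf] with z hz
  convert hz using 1
  funext n
  rw [h, mul_zpow]
  ring

theorem ramify {g : ℂ → ℂ} {f f' : ℂ⸨X⸩} {l : ℕ} (hl : 0 < l) (hf : HasLaurentExpansion g f)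
    (h : ∀ n : ℤ, f'.coeff (l * n) = f.coeff n)
    (h' : ∀ n : ℤ, n ∉ Set.range (fun k : ℤ => l * k) → f'.coeff n = 0) :
    HasLaurentExpansion (fun z => g (z ^ l)) f' := by
  have ht : Tendsto (fun z : ℂ => z ^ l) (𝓝[≠] 0) (𝓝[≠] 0) := by
    refine tendsto_nhdsWithin_iff.mpr ⟨?_, ?_⟩
    · exact ((continuous_pow l).tendsto' 0 0 (zero_pow hl.ne')).mono_left nhdsWithin_le_nhds
    · filter_upwards [self_mem_nhdsWithin] with z hz using pow_ne_zero l hz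
  have hinj : Function.Injective fun k : ℤ => (l : ℤ) * k :=
    mul_right_injective₀ (by exact_mod_cast hl.ne')
  filter_upwards [ht.eventually hf] with z hz
  rw [← hinj.hasSum_iff (fun n hn => by rw [h' n hn, zero_mul])]
  convert hz using 1
  funext n
  simp [h, zpow_mul]

end HasLaurentExpansion

/-! ### The three base fields -/

/-- The choice of the base field `K`. -/
inductive BaseField
  /-- `K = ℳ(ℂ)`, the meromorphic functions on the whole plane. -/
  | meromorphic
  /-- `K = ℂ({z})`, the germs at `0` of meromorphic functions. -/
  | convergent
  /-- `K = ℂ((z))`, the formal Laurent series. -/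
  | formal

namespace BaseField

/-- The base field, as a subfield of `ℂ((z))`: a (germ of) meromorphic function is identified with
its Laurent expansion at `0`, so that `ℳ(ℂ) ⊂ ℂ({z}) ⊂ ℂ((z))`. -/
noncomputable def toSubfield : BaseField → Subfield ℂ⸨X⸩
  | meromorphic =>
    { carrier := {f | ∃ g : ℂ → ℂ, Meromorphic g ∧ HasLaurentExpansion g f}
      zero_mem' := ⟨0, Meromorphic.const 0, .zero⟩
      one_mem' := ⟨1, Meromorphic.const 1, .one⟩
      neg_mem' := fun ⟨g, hg, h⟩ => ⟨-g, hg.neg, h.neg⟩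
      add_mem' := fun ⟨g, hg, h⟩ ⟨g', hg', h'⟩ => ⟨g + g', hg.add hg', h.add h'⟩
      mul_mem' := fun ⟨g, hg, h⟩ ⟨g', hg', h'⟩ => ⟨g * g', hg.mul hg', h.mul h'⟩
      inv_mem' := fun _ ⟨g, hg, h⟩ => ⟨g⁻¹, hg.inv, h.inv⟩ }
  | convergent =>
    { carrier := {f | ∃ g : ℂ → ℂ, HasLaurentExpansion g f}
      zero_mem' := ⟨0, .zero⟩
      one_mem' := ⟨1, .one⟩
      neg_mem' := fun ⟨g, h⟩ => ⟨-g, h.neg⟩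
      add_mem' := fun ⟨g, h⟩ ⟨g', h'⟩ => ⟨g + g', h.add h'⟩
      mul_mem' := fun ⟨g, h⟩ ⟨g', h'⟩ => ⟨g * g', h.mul h'⟩
      inv_mem' := fun _ ⟨g, h⟩ => ⟨g⁻¹, h.inv⟩ }
  | formal => ⊤

end BaseField

/-- The field `K`. -/
abbrev BaseField.K (b : BaseField) : Type := b.toSubfield

/-- The `z`-adic valuation `v₀` (with the junk value `0` at `0`). -/
noncomputable def BaseField.val {b : BaseField} (a : b.K) : ℤ := (a : ℂ⸨X⸩).order

/-! ### The automorphisms `f(z) ↦ f(qz)` and the ramification `z ↦ z ^ l` -/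

/-- The endomorphism `f(z) ↦ f(cz)` of `ℂ((z))`, that is `∑ aₙ zⁿ ↦ ∑ cⁿ aₙ zⁿ`. -/
noncomputable def laurentScale (c : ℂˣ) : ℂ⸨X⸩ →+* ℂ⸨X⸩ where
  toFun f :=
    { coeff := fun n => (c : ℂ) ^ n * f.coeff n
      isPWO_support' := f.isPWO_support.mono fun n hn h0 => hn (by simp only [h0, mul_zero]) }
  map_one' := by
    ext n
    by_cases hn : n = 0 <;> simp [HahnSeries.coeff_one, hn]
  map_zero' := by ext n; simp
  map_add' f g := by ext n; simp [mul_add]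
  map_mul' f g := by
    ext n
    rw [HahnSeries.coeff_mul]
    simp only [HahnSeries.coeff_mul, Finset.mul_sum]
    refine Finset.sum_congr ?_ fun p hp => ?_
    · ext p
      have hc : ∀ m : ℤ, (c : ℂ) ^ m ≠ 0 := fun m => zpow_ne_zero m c.ne_zero
      simp [Finset.mem_antidiagonal, HahnSeries.mem_support, hc]
    · rw [← (Finset.mem_antidiagonal.mp hp).2.2, zpow_add₀ c.ne_zero]
      ring

@[simp]
theorem laurentScale_coeff (c : ℂˣ) (f : ℂ⸨X⸩) (n : ℤ) :
    (laurentScale c f).coeff n = (c : ℂ) ^ n * f.coeff n := rfl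

/-- The embedding `f(z) ↦ f(z ^ l)` of `ℂ((z))` into itself. -/
noncomputable def laurentRamify (l : ℕ+) : ℂ⸨X⸩ →+* ℂ⸨X⸩ :=
  HahnSeries.embDomainRingHom (AddMonoidHom.mulLeft (l : ℤ))
    (mul_right_injective₀ (by exact_mod_cast l.ne_zero))
    (fun _ _ => mul_le_mul_iff_right₀ (by exact_mod_cast l.pos))

theorem laurentRamify_coeff_mul (l : ℕ+) (f : ℂ⸨X⸩) (n : ℤ) :
    (laurentRamify l f).coeff ((l : ℕ) * n) = f.coeff n :=
  HahnSeries.embDomain_coeff (f := ⟨⟨fun n : ℤ => ((l : ℕ) : ℤ) * n, _⟩, _⟩) ..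

theorem laurentRamify_coeff_of_notMem (l : ℕ+) (f : ℂ⸨X⸩) (n : ℤ)
    (hn : n ∉ Set.range fun k : ℤ => ((l : ℕ) : ℤ) * k) : (laurentRamify l f).coeff n = 0 :=
  HahnSeries.embDomain_of_notMem_range hn

theorem laurentScale_ramify (l : ℕ+) (c : ℂˣ) (f : ℂ⸨X⸩) :
    laurentScale c (laurentRamify l f) = laurentRamify l (laurentScale (c ^ (l : ℕ)) f) := by
  ext n
  rw [laurentScale_coeff]
  by_cases hn : n ∈ Set.range fun k : ℤ => ((l : ℕ) : ℤ) * k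
  · obtain ⟨k, rfl⟩ := hn
    simp only [laurentRamify_coeff_mul, laurentScale_coeff]
    rw [zpow_mul, zpow_natCast, Units.val_pow_eq_pow_val]
  · rw [laurentRamify_coeff_of_notMem l f n hn, laurentRamify_coeff_of_notMem l _ n hn, mul_zero]

namespace BaseField

theorem scale_mem (b : BaseField) (c : ℂˣ) {f : ℂ⸨X⸩} (hf : f ∈ b.toSubfield) :
    laurentScale c f ∈ b.toSubfield := by
  match b, hf with
  | meromorphic, ⟨g, hg, h⟩ =>
    exact ⟨fun z => g (c * z), fun x => (hg _).comp_analyticAt (g := fun z => (c : ℂ) * z)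
      (by fun_prop), h.scale c.ne_zero (laurentScale_coeff c f)⟩
  | convergent, ⟨g, h⟩ => exact ⟨_, h.scale c.ne_zero (laurentScale_coeff c f)⟩
  | formal, _ => exact Subfield.mem_top _

theorem ramify_mem (b : BaseField) (l : ℕ+) {f : ℂ⸨X⸩} (hf : f ∈ b.toSubfield) :
    laurentRamify l f ∈ b.toSubfield := by
  match b, hf with
  | meromorphic, ⟨g, hg, h⟩ =>
    exact ⟨fun z => g (z ^ (l : ℕ)), fun x => (hg _).comp_analyticAt
      (g := fun z : ℂ => z ^ (l : ℕ)) (by fun_prop),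
      h.ramify l.pos (laurentRamify_coeff_mul l f) (laurentRamify_coeff_of_notMem l f)⟩
  | convergent, ⟨g, h⟩ =>
    exact ⟨_, h.ramify l.pos (laurentRamify_coeff_mul l f) (laurentRamify_coeff_of_notMem l f)⟩
  | formal, _ => exact Subfield.mem_top _

/-- The automorphism `σ_q : f(z) ↦ f(qz)` of `K`. -/
noncomputable def sigma (b : BaseField) (q : ℂˣ) : b.K →+* b.K :=
  (laurentScale q).restrict b.toSubfield b.toSubfield fun _ => b.scale_mem q

/-- The embedding `f(z) ↦ f(z_l ^ l)` of `K` into its ramified extension `K_l`, the field of the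
same kind in the variable `z_l`. -/
noncomputable def ramify (b : BaseField) (l : ℕ+) : b.K →+* b.K :=
  (laurentRamify l).restrict b.toSubfield b.toSubfield fun _ => b.ramify_mem l

theorem sigma_ramify (b : BaseField) (l : ℕ+) (c : ℂˣ) (f : b.K) :
    b.sigma c (b.ramify l f) = b.ramify l (b.sigma (c ^ (l : ℕ)) f) :=
  Subtype.ext (laurentScale_ramify l c f)

/-- The ramified extension `K_l` of `K`, with variable `z_l` such that `z_l ^ l = z`: a copy of `K`
whose elements are read as functions of `z_l`. It is a `K`-algebra through `f(z) ↦ f(z_l ^ l)`. -/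
def Ramified (b : BaseField) (_l : ℕ+) : Type := b.K

noncomputable instance (b : BaseField) (l : ℕ+) : Field (b.Ramified l) :=
  inferInstanceAs (Field b.K)

noncomputable instance (b : BaseField) (l : ℕ+) : Algebra b.K (b.Ramified l) :=
  RingHom.toAlgebra (S := b.Ramified l) (b.ramify l)

/-- The `z_l`-adic valuation on `K_l`. -/
noncomputable def Ramified.val {b : BaseField} {l : ℕ+} (a : b.Ramified l) : ℤ :=
  BaseField.val (b := b) a

/-- The automorphism `f(z_l) ↦ f(c z_l)` of `K_l`. -/
noncomputable def Ramified.sigma (b : BaseField) (l : ℕ+) (c : ℂˣ) :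
    b.Ramified l →+* b.Ramified l :=
  BaseField.sigma b c

theorem Ramified.sigma_algebraMap (b : BaseField) (l : ℕ+) (c : ℂˣ) (f : b.K) :
    Ramified.sigma b l c (algebraMap b.K (b.Ramified l) f) =
      algebraMap b.K (b.Ramified l) (b.sigma (c ^ (l : ℕ)) f) :=
  b.sigma_ramify l c f

end BaseField

/-- A compatible family of roots of `q`: `q₁ = q` and `q_{lm} ^ l = q_m`
(for instance `q_l = exp(-2iπτ/l)` where `q = exp(-2iπτ)`). -/
structure CompatibleRoots (q : ℂˣ) where
  root : ℕ+ → ℂˣ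
  root_one : root 1 = q
  root_mul_pow : ∀ l m : ℕ+, root (l * m) ^ (l : ℕ) = root m

theorem CompatibleRoots.root_pow {q : ℂˣ} (ρ : CompatibleRoots q) (l : ℕ+) :
    ρ.root l ^ (l : ℕ) = q := by
  simpa [ρ.root_one] using ρ.root_mul_pow l 1

/-! ### `q`-difference modules

A `q`-difference module over `(K, σ)` is a finite dimensional `K`-vector space `M` together with
a bijective `σ`-linear map `Φ : M → M`. -/

section Modules

variable {k : Type*} [Field k] {σ : k →+* k} {V : Type*} [AddCommGroup V] [Module k V]

/-- `N` is a submodule of the `q`-difference module `(V, Φ)`: a subspace stable under `Φ` and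
`Φ⁻¹`. -/
def IsSubmodule (Φ : V →ₛₗ[σ] V) (N : Submodule k V) : Prop :=
  ∀ x, Φ x ∈ N ↔ x ∈ N

/-- The operator induced by `Φ` on a submodule. -/
def subOp (Φ : V →ₛₗ[σ] V) (N : Submodule k V) (hN : IsSubmodule Φ N) : N →ₛₗ[σ] N :=
  Φ.restrict fun x hx => (hN x).mpr hx

/-- The operator induced by `Φ` on the quotient by a submodule. -/
def quotOp (Φ : V →ₛₗ[σ] V) (N : Submodule k V) (hN : IsSubmodule Φ N) :
    (V ⧸ N) →ₛₗ[σ] (V ⧸ N) :=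
  N.mapQ N Φ fun x hx => (hN x).mpr hx

/-- A triangularisation of `(V, Φ)`: a tower of submodules `0 = F₀ ⊂ ⋯ ⊂ Fₙ = V` such that
`Fᵢ₊₁ / Fᵢ` is of rank one, with a basis `e` such that `Φ e = aᵢ e`, `aᵢ ≠ 0`; that is,
`Fᵢ₊₁ / Fᵢ` is isomorphic to `𝒟_q / 𝒟_q (σ - aᵢ)`. -/
structure IsTriangularisation (Φ : V →ₛₗ[σ] V) {n : ℕ} (F : Fin (n + 1) → Submodule k V)
    (a : Fin n → k) : Prop where
  bot : F 0 = ⊥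
  top : F (Fin.last n) = ⊤
  isSubmodule : ∀ i, IsSubmodule Φ (F i)
  ne_zero : ∀ i, a i ≠ 0
  step : ∀ i : Fin n, ∃ e, e ∉ F i.castSucc ∧
    F i.succ = F i.castSucc ⊔ Submodule.span k {e} ∧ Φ e - a i • e ∈ F i.castSucc

end Modules

section Newton

variable {b : BaseField} {q : ℂˣ} (ρ : CompatibleRoots q)
  {M : Type*} [AddCommGroup M] [Module b.K M]

/-- The operator `σ_{q_l} ⊗ Φ` on `M_l = K_l ⊗ M`. -/
noncomputable def ramifiedOp (Φ : M →ₛₗ[b.sigma q] M) (l : ℕ+) :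
    (b.Ramified l ⊗[b.K] M) →ₛₗ[BaseField.Ramified.sigma b l (ρ.root l)]
      (b.Ramified l ⊗[b.K] M) :=
  let s : b.Ramified l →ₛₗ[b.sigma q] b.Ramified l :=
    { toFun := BaseField.Ramified.sigma b l (ρ.root l)
      map_add' := map_add _
      map_smul' := fun c x => by
        rw [Algebra.smul_def, map_mul, BaseField.Ramified.sigma_algebraMap, ρ.root_pow,
          Algebra.smul_def] }
  { toFun := TensorProduct.map s Φ
    map_add' := map_add _
    map_smul' := fun c x => by
      induction x with
      | zero => simp
      | add x y hx hy => rw [smul_add, map_add, hx, hy, map_add, smul_add]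
      | tmul x m =>
        rw [TensorProduct.smul_tmul', TensorProduct.map_tmul, TensorProduct.map_tmul,
          TensorProduct.smul_tmul']
        exact congrArg (· ⊗ₜ[b.K] Φ m) (map_mul (BaseField.Ramified.sigma b l (ρ.root l)) c x) }

@[simp]
theorem ramifiedOp_tmul (Φ : M →ₛₗ[b.sigma q] M) (l : ℕ+) (x : b.Ramified l) (m : M) :
    ramifiedOp ρ Φ l (x ⊗ₜ m) = BaseField.Ramified.sigma b l (ρ.root l) x ⊗ₜ Φ m := rfl

/-- `r` is obtained by the following recipe: ramify so as to make `M` triangularisable, with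
rank one quotients `𝒟_q / 𝒟_q (σ - aᵢ)`; then `r μ` is the number of indices `i` such that
`v(aᵢ) / l = μ`, where `v` is the `z_l`-adic valuation. -/
def IsNewtonFunction (Φ : M →ₛₗ[b.sigma q] M) (r : ℚ → ℕ) : Prop :=
  ∃ (l : ℕ+) (n : ℕ) (F : Fin (n + 1) → Submodule (b.Ramified l) (b.Ramified l ⊗[b.K] M))
    (a : Fin n → b.Ramified l), IsTriangularisation (ramifiedOp ρ Φ l) F a ∧
      ∀ μ : ℚ, r μ = Nat.card {i : Fin n // ((a i).val : ℚ) / ((l : ℕ) : ℚ) = μ}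

open Classical in
/-- The Newton function `r_M` of the `q`-difference module `(M, Φ)`. -/
noncomputable def newtonFunction (Φ : M →ₛₗ[b.sigma q] M) : ℚ → ℕ :=
  if h : ∃ r, IsNewtonFunction ρ Φ r then h.choose else 0

/-- The set `S(M)` of the slopes of `(M, Φ)`: the support of its Newton function. -/
def slopes (Φ : M →ₛₗ[b.sigma q] M) : Set ℚ :=
  {μ | newtonFunction ρ Φ μ ≠ 0}

/-- `N` is a submodule of `(M, Φ)` that is pure of slope `μ`: `S(N) = {μ}`. -/
def IsPureSubmodule (Φ : M →ₛₗ[b.sigma q] M) (μ : ℚ) (N : Submodule b.K M) : Prop :=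
  ∃ hN : IsSubmodule Φ N, slopes ρ (subOp Φ N hN) = {μ}

end Newton

end QDiff

/-! Having a slope forces `M` to be triangularisable over some `K_l`, where everything reduces to
scalar equations. Let a tower there have adjacent rank one quotients with scalar `β` below and `a`
above. They can be exchanged as soon as `β σ(f) - a f = g` is solvable for every `g`. After division
this reads `σ(f) = u f + g` or `f = u σ(f) + g` with `u` of positive valuation, and coefficients are
found recursively. If `v(β) < v(a)` the recursion divides by powers `c ^ n` with `|c| > 1`, so
convergence is preserved, and the functional equation itself continues a convergent solution
meromorphically to the whole plane. If `v(β) > v(a)` the solution is only formal; this is why the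
convergent case needs the maximal slope.

Hence all scalars of slope `μ` can be moved to the bottom (`Tower.exists_filter`), giving `P ⊂ M_l`
whose slopes are disjoint from those of `M_l / P`. By Jordan–Hölder (`Tower.map_eq_map`), `P`
contains every stable subspace with slopes equal to `μ` (`Tower.le_of_disjoint`). In particular it
contains its Galois conjugates, so it comes from a submodule `N` of `M` by Kummer descent
(`Tower.exists_range_baseChange_eq`).

The tower gives the rank of `N` and the slopes of `N` and `M / N`. If `N'` is pure of slope `μ`,
then `N' / (N ∩ N')` is a quotient of `N'` and a submodule of `M / N`. It has no slopes, so it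
vanishes and `N' ⊂ N` (`le_of_slopes_disjoint`). -/

namespace QDiff

/-! ### Towers with rank one quotients: Jordan–Hölder and reordering. -/

section Tower

variable {k : Type*} [Field k] {σ : k →+* k} {V : Type*} [AddCommGroup V] [Module k V]

theorem mem_sup_span_singleton_iff {B : Submodule k V} {e x : V} :
    x ∈ B ⊔ Submodule.span k {e} ↔ ∃ b ∈ B, ∃ c : k, b + c • e = x := by
  simp only [Submodule.mem_sup, Submodule.mem_span_singleton]
  constructor
  · rintro ⟨b, hb, _, ⟨c, rfl⟩, h⟩
    exact ⟨b, hb, c, h⟩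
  · rintro ⟨b, hb, c, h⟩
    exact ⟨b, hb, _, ⟨c, rfl⟩, h⟩

/-- `Tower Φ A B s` says that there is a tower of `Φ`-stable subspaces from `A` to `B` whose
successive quotients have rank one, with bases on which `Φ` acts by the scalars listed in `s`. -/
inductive Tower (Φ : V →ₛₗ[σ] V) (A : Submodule k V) : Submodule k V → Multiset k → Prop
  | refl (hA : ∀ x ∈ A, Φ x ∈ A) : Tower Φ A A 0
  | step {B B' : Submodule k V} {s : Multiset k} (e : V) (a : k) (h : Tower Φ A B s) (he : e ∉ B)
      (ha : a ≠ 0) (hΦ : Φ e - a • e ∈ B) (hB : B' = B ⊔ Submodule.span k {e}) :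
      Tower Φ A B' (a ::ₘ s)

namespace Tower

variable {Φ : V →ₛₗ[σ] V} {A B : Submodule k V} {s : Multiset k}

theorem le (h : Tower Φ A B s) : A ≤ B := by
  induction h with
  | refl => exact le_rfl
  | step e a h he ha hΦ hB ih => exact hB ▸ ih.trans le_sup_left

theorem stable (h : Tower Φ A B s) : ∀ x ∈ B, Φ x ∈ B := by
  induction h with
  | refl hA => exact hA
  | step e a h he ha hΦ hB ih =>
    subst hB
    intro x hx
    obtain ⟨b, hb, c, rfl⟩ := mem_sup_span_singleton_iff.mp hx
    refine mem_sup_span_singleton_iff.mpr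
      ⟨Φ b + σ c • (Φ e - a • e), add_mem (ih b hb) (Submodule.smul_mem _ _ hΦ), σ c * a, ?_⟩
    rw [map_add, LinearMap.map_smulₛₗ, smul_sub, mul_smul]
    abel

theorem stable_bot (h : Tower Φ A B s) : ∀ x ∈ A, Φ x ∈ A := by
  induction h with
  | refl hA => exact hA
  | step e a h he ha hΦ hB ih => exact ih

theorem ne_zero (h : Tower Φ A B s) : ∀ a ∈ s, a ≠ 0 := by
  induction h with
  | refl => simp
  | step e a h he ha hΦ hB ih => simpa using ⟨ha, ih⟩

/-- For `x = b + c • e`, the coefficient of `e` in `Φ x` is `σ c * a`, so `Φ x ∈ B` forces `c = 0`.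
Stability under `Φ⁻¹` thus passes down a tower from its top, and `Tower` need only record stability
under `Φ`. -/
theorem isSubmodule_of_step {B : Submodule k V} {e : V} {a : k} (hB : ∀ x ∈ B, Φ x ∈ B)
    (he : e ∉ B) (ha : a ≠ 0) (hΦ : Φ e - a • e ∈ B)
    (hB' : IsSubmodule Φ (B ⊔ Submodule.span k {e})) : IsSubmodule Φ B := by
  refine fun x => ⟨fun hx => ?_, hB x⟩
  obtain ⟨b, hb, c, rfl⟩ := mem_sup_span_singleton_iff.mp ((hB' x).mp (Submodule.mem_sup_left hx))
  have h1 : (σ c * a) • e ∈ B := by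
    have : (σ c * a) • e = Φ (b + c • e) - Φ b - σ c • (Φ e - a • e) := by
      rw [map_add, LinearMap.map_smulₛₗ, smul_sub, mul_smul]
      abel
    rw [this]
    exact sub_mem (sub_mem hx (hB b hb)) (Submodule.smul_mem _ _ hΦ)
  by_cases hc : c = 0
  · simpa [hc] using hb
  · exact absurd ((Submodule.smul_mem_iff _ (mul_ne_zero ((map_ne_zero σ).mpr hc) ha)).mp h1) he

theorem isSubmodule (h : Tower Φ A B s) (hB : IsSubmodule Φ B) : IsSubmodule Φ A := by
  induction h with
  | refl => exact hB
  | step e a h he ha hΦ hB' ih => exact ih (isSubmodule_of_step h.stable he ha hΦ (hB' ▸ hB))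

theorem eq_of_zero (h : Tower Φ A B 0) : A = B := by
  generalize hs : (0 : Multiset k) = s at h
  cases h with
  | refl => rfl
  | step e a h => exact absurd hs.symm (Multiset.cons_ne_zero)

theorem finrank_eq [FiniteDimensional k V] (h : Tower Φ A B s) :
    Module.finrank k B = Module.finrank k A + s.card := by
  induction h with
  | refl => simp
  | @step B B' s e a h he ha hΦ hB ih =>
    subst hB
    have h0 : e ≠ 0 := fun h0 => he (h0 ▸ B.zero_mem)
    have h1 := Submodule.finrank_sup_add_finrank_inf_eq B (Submodule.span k {e})
    have h2 : B ⊓ Submodule.span k {e} = ⊥ :=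
      (Submodule.disjoint_span_singleton' h0).mpr he |>.eq_bot
    rw [h2, finrank_bot, finrank_span_singleton h0, ih] at h1
    simp only [Multiset.card_cons]
    omega

/-- A tower induces towers on the intersections and the sums with a stable subspace. -/
theorem exists_inf_sup (h : Tower Φ A B s) {W : Submodule k V} (hW : ∀ x ∈ W, Φ x ∈ W) :
    ∃ s₁ s₂, s = s₁ + s₂ ∧ Tower Φ (A ⊓ W) (B ⊓ W) s₁ ∧ Tower Φ (A ⊔ W) (B ⊔ W) s₂ := by
  induction h with
  | refl hA =>
    refine ⟨0, 0, by simp, .refl fun x hx => ⟨hA x hx.1, hW x hx.2⟩, .refl fun x hx => ?_⟩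
    obtain ⟨y, hy, z, hz, rfl⟩ := Submodule.mem_sup.mp hx
    rw [map_add]
    exact Submodule.add_mem_sup (hA y hy) (hW z hz)
  | @step B B' s e a h he ha hΦ hB ih =>
    subst hB
    obtain ⟨s₁, s₂, rfl, h₁, h₂⟩ := ih
    -- The rank one quotient generated by `e` survives in exactly one of the two towers. If `e = b +
    -- w`, then `w` generates it in the intersection and the sum does not grow; otherwise it appears
    -- in the sum.
    by_cases hc : e ∈ B ⊔ W
    · obtain ⟨b, hb, w, hw, rfl⟩ := Submodule.mem_sup.mp hc
      have hwB : w ∉ B := fun h' => he (add_mem hb h')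
      refine ⟨a ::ₘ s₁, s₂, by simp, .step w a h₁ (fun h' => hwB h'.1) ha ⟨?_, ?_⟩ ?_, ?_⟩
      · have : Φ w - a • w = Φ (b + w) - a • (b + w) - (Φ b - a • b) := by
          rw [map_add, smul_add]; abel
        rw [this]
        exact sub_mem hΦ (sub_mem (h.stable b hb) (B.smul_mem _ hb))
      · exact sub_mem (hW w hw) (W.smul_mem _ hw)
      · apply le_antisymm
        · rintro x ⟨hx, hxW⟩
          obtain ⟨b', hb', c, rfl⟩ := mem_sup_span_singleton_iff.mp hx
          refine mem_sup_span_singleton_iff.mpr ⟨b' + c • b, ⟨add_mem hb' (B.smul_mem _ hb), ?_⟩,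
            c, by rw [smul_add]; abel⟩
          have : b' + c • b = b' + c • (b + w) - c • w := by rw [smul_add]; abel
          rw [this]
          exact sub_mem hxW (W.smul_mem _ hw)
        · rw [sup_le_iff, Submodule.span_singleton_le_iff_mem]
          refine ⟨inf_le_inf_right _ le_sup_left, mem_sup_span_singleton_iff.mpr
            ⟨-b, neg_mem hb, 1, by rw [one_smul]; abel⟩, hw⟩
      · have : B ⊔ Submodule.span k {b + w} ⊔ W = B ⊔ W := by
          apply le_antisymm
          · rw [sup_le_iff, sup_le_iff, Submodule.span_singleton_le_iff_mem]
            exact ⟨⟨le_sup_left, hc⟩, le_sup_right⟩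
          · exact sup_le_sup_right le_sup_left _
        rwa [this]
    · refine ⟨s₁, a ::ₘ s₂, by simp, ?_, .step e a h₂ hc ha (Submodule.mem_sup_left hΦ)
        (sup_right_comm _ _ _)⟩
      have : (B ⊔ Submodule.span k {e}) ⊓ W = B ⊓ W := by
        refine le_antisymm ?_ (inf_le_inf_right _ le_sup_left)
        rintro x ⟨hx, hxW⟩
        obtain ⟨b, hb, c, rfl⟩ := mem_sup_span_singleton_iff.mp hx
        by_cases h0 : c = 0
        · subst h0
          simpa using And.intro hb hxW
        · refine absurd ((Submodule.smul_mem_iff _ h0).mp ?_) hc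
          have : c • e = -b + (b + c • e) := by abel
          rw [this]
          exact Submodule.add_mem_sup (neg_mem hb) hxW
      rwa [this]

theorem exists_add (h : Tower Φ A B s) {W : Submodule k V} (hW : ∀ x ∈ W, Φ x ∈ W) (hAW : A ≤ W)
    (hWB : W ≤ B) : ∃ s₁ s₂, s = s₁ + s₂ ∧ Tower Φ A W s₁ ∧ Tower Φ W B s₂ := by
  obtain ⟨s₁, s₂, h0, h1, h2⟩ := h.exists_inf_sup hW
  rw [inf_eq_left.mpr hAW, inf_eq_right.mpr hWB] at h1
  rw [sup_eq_right.mpr hAW, sup_eq_left.mpr hWB] at h2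
  exact ⟨s₁, s₂, h0, h1, h2⟩

/-- A function on the scalars that is constant on the isomorphism classes of rank one modules. -/
def IsGaugeInvariant (σ : k →+* k) {Γ : Type*} (w : k → Γ) : Prop :=
  ∀ a a' c : k, a ≠ 0 → a' ≠ 0 → c ≠ 0 → σ c * a = a' * c → w a = w a'

/-- A rank one quotient admits only towers of one step, and two generators of it differ by a factor
`c ≠ 0`. Computing `Φ` on both gives `σ c * a = a' * c`, which is gauge equivalence. -/
theorem eq_singleton_of_rank_one {Γ : Type*} {w : k → Γ} (hw : IsGaugeInvariant σ w) {e : V} {a : k}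
    (he : e ∉ A) (ha : a ≠ 0) (hΦ : Φ e - a • e ∈ A)
    (h : Tower Φ A (A ⊔ Submodule.span k {e}) s) : s.map w = {w a} := by
  generalize hB : A ⊔ Submodule.span k {e} = B at h
  cases h with
  | refl => exact absurd (hB ▸ Submodule.mem_sup_right (Submodule.mem_span_singleton_self e)) he
  | @step C B s e' a' h he' ha' hΦ' hB' =>
    have hA := h.le
    have heq : A = C := by
      refine le_antisymm hA fun x hx => ?_
      have hx' : x ∈ A ⊔ Submodule.span k {e} := by rw [hB, hB']; exact Submodule.mem_sup_left hx
      obtain ⟨b, hb, c, rfl⟩ := mem_sup_span_singleton_iff.mp hx'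
      by_cases h0 : c = 0
      · simpa [h0] using hb
      · have h1 : c • e ∈ C := by simpa using sub_mem hx (hA hb)
        have h2 : A ⊔ Submodule.span k {e} ≤ C := by
          rw [sup_le_iff, Submodule.span_singleton_le_iff_mem]
          exact ⟨hA, (Submodule.smul_mem_iff _ h0).mp h1⟩
        refine absurd (h2 ?_) he'
        rw [hB, hB']
        exact Submodule.mem_sup_right (Submodule.mem_span_singleton_self e')
    subst heq
    have hs : s = 0 := by
      cases h with
      | refl => rfl
      | step e'' a'' h he'' ha'' hΦ'' hB'' =>
        refine absurd (h.le ?_) he''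
        rw [hB'']
        exact Submodule.mem_sup_right (Submodule.mem_span_singleton_self _)
    subst hs
    have he1 : e' ∈ A ⊔ Submodule.span k {e} := by
      rw [hB, hB']; exact Submodule.mem_sup_right (Submodule.mem_span_singleton_self e')
    obtain ⟨b, hb, c, rfl⟩ := mem_sup_span_singleton_iff.mp he1
    have hc : c ≠ 0 := by
      rintro rfl
      exact he' (by simpa using hb)
    have h1 : (σ c * a - a' * c) • e ∈ A := by
      have : (σ c * a - a' * c) • e = (Φ (b + c • e) - a' • (b + c • e)) - (Φ b - a' • b)
          - σ c • (Φ e - a • e) := by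
        rw [map_add, LinearMap.map_smulₛₗ, smul_sub, sub_smul, mul_smul, mul_smul, smul_add]
        abel
      rw [this]
      exact sub_mem (sub_mem hΦ' (sub_mem (h.stable b hb) (A.smul_mem _ hb))) (A.smul_mem _ hΦ)
    have h2 : σ c * a - a' * c = 0 := by
      by_contra h0
      exact he ((Submodule.smul_mem_iff _ h0).mp h1)
    simp [hw a a' c ha ha' hc (sub_eq_zero.mp h2)]

/-- The Jordan–Hölder theorem for towers. -/
theorem map_eq_map {Γ : Type*} {w : k → Γ} (hw : IsGaugeInvariant σ w) {t : Multiset k}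
    (h : Tower Φ A B s) (h' : Tower Φ A B t) : s.map w = t.map w := by
  induction h generalizing t with
  | refl =>
    cases h' with
    | refl => rfl
    | step e a h he ha hΦ hB =>
      refine absurd (h.le ?_) he
      rw [hB]
      exact Submodule.mem_sup_right (Submodule.mem_span_singleton_self _)
  | step e a h he ha hΦ hB ih =>
    subst hB
    -- The second tower is cut at the penultimate term of the first.
    obtain ⟨t₁, t₂, rfl, h₁, h₂⟩ := h'.exists_add h.stable h.le le_sup_left
    rw [Multiset.map_cons, Multiset.map_add, ih h₁, eq_singleton_of_rank_one hw he ha hΦ h₂,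
      add_comm, Multiset.singleton_add]

/-- Transport of towers along a semilinear map. -/
theorem map {k' : Type*} [Field k'] {σ' : k' →+* k'} {V' : Type*} [AddCommGroup V'] [Module k' V']
    {Φ' : V' →ₛₗ[σ'] V'} {τ : k →+* k'} (f : V →ₛₗ[τ] V') (hf : ∀ x, f (Φ x) = Φ' (f x))
    (hA : ∀ C : Submodule k V, A ≤ C → ∀ x, f x ∈ Submodule.span k' (f '' C) → x ∈ C)
    (h : Tower Φ A B s) :
    Tower Φ' (Submodule.span k' (f '' A)) (Submodule.span k' (f '' B)) (s.map τ) := by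
  have key : ∀ C : Submodule k V, ∀ x ∈ C, f x ∈ Submodule.span k' (f '' C) := fun C x hx =>
    Submodule.subset_span ⟨x, hx, rfl⟩
  induction h with
  | refl hs =>
    refine .refl fun x hx => ?_
    induction hx using Submodule.span_induction with
    | mem x hx =>
      obtain ⟨y, hy, rfl⟩ := hx
      rw [← hf]
      exact key _ _ (hs y hy)
    | zero => simp
    | add x y _ _ hx hy => rw [map_add]; exact add_mem hx hy
    | smul c x _ hx => rw [LinearMap.map_smulₛₗ]; exact Submodule.smul_mem _ _ hx
  | @step B B' s e a h he ha hΦ hB ih =>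
    subst hB
    rw [Multiset.map_cons]
    refine .step (f e) (τ a) ih (fun h' => he (hA _ h.le _ h')) ((map_ne_zero τ).mpr ha) ?_ ?_
    · rw [← hf, ← LinearMap.map_smulₛₗ, ← map_sub]
      exact key _ _ hΦ
    · apply le_antisymm
      · rw [Submodule.span_le]
        rintro _ ⟨x, hx, rfl⟩
        obtain ⟨b, hb, c, rfl⟩ := mem_sup_span_singleton_iff.mp hx
        rw [map_add, LinearMap.map_smulₛₗ]
        exact mem_sup_span_singleton_iff.mpr ⟨_, key _ _ hb, _, rfl⟩
      · rw [sup_le_iff, Submodule.span_singleton_le_iff_mem]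
        exact ⟨Submodule.span_mono (Set.image_mono (SetLike.coe_subset_coe.mpr le_sup_left)),
          key _ _ (Submodule.mem_sup_right (Submodule.mem_span_singleton_self e))⟩

theorem map_of_surjective {k' : Type*} [Field k'] {σ' : k' →+* k'} {V' : Type*} [AddCommGroup V']
    [Module k' V'] {Φ' : V' →ₛₗ[σ'] V'} {τ : k →+* k'} [RingHomSurjective τ] (f : V →ₛₗ[τ] V')
    (hf : ∀ x, f (Φ x) = Φ' (f x)) (hA : LinearMap.ker f ≤ A) (h : Tower Φ A B s) :
    Tower Φ' (A.map f) (B.map f) (s.map τ) := by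
  have key : ∀ C : Submodule k V, Submodule.span k' (f '' C) = C.map f := fun C => by
    rw [← Submodule.map_coe, Submodule.span_eq]
  have := h.map f hf fun C hC x hx => by
    rw [key] at hx
    obtain ⟨y, hy, hxy⟩ := hx
    have h1 : x - y ∈ C := hC (hA (by simp [hxy]))
    simpa using add_mem h1 hy
  rwa [key, key] at this

/-- Transport of towers along an injective linear map. -/
theorem comap {V' : Type*} [AddCommGroup V'] [Module k V'] {Φ' : V' →ₛₗ[σ] V'} (f : V' →ₗ[k] V)
    (hf : ∀ x, f (Φ' x) = Φ (f x)) (hB : B ≤ LinearMap.range f) (h : Tower Φ A B s) :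
    Tower Φ' (A.comap f) (B.comap f) s := by
  induction h with
  | refl hs => exact .refl fun x hx => by simpa [hf] using hs _ hx
  | @step B B' s e a h he ha hΦ hB' ih =>
    subst hB'
    have hB1 := le_sup_left.trans hB
    obtain ⟨e, rfl⟩ := hB (Submodule.mem_sup_right (Submodule.mem_span_singleton_self e))
    refine .step e a (ih hB1) he ha (by simpa [hf] using hΦ) ?_
    ext x
    rw [mem_sup_span_singleton_iff, Submodule.mem_comap, mem_sup_span_singleton_iff]
    constructor
    · rintro ⟨b, hb, c, hx⟩
      refine ⟨x - c • e, ?_, c, by abel⟩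
      rw [Submodule.mem_comap, map_sub, map_smul, ← hx, add_sub_cancel_right]
      exact hb
    · rintro ⟨b, hb, c, rfl⟩
      exact ⟨f b, hb, c, by simp⟩

/-- If the scalar equations `b σ(f) - a f = c` are solvable, then so is the equation
`Φ f - a f = c` modulo `A`. -/
theorem exists_solution {a : k} (hs : ∀ b ∈ s, ∀ c, ∃ f, b * σ f - a * f = c)
    (h : Tower Φ A B s) : ∀ x ∈ B, ∃ y ∈ B, Φ y - a • y - x ∈ A := by
  induction h with
  | refl => exact fun x hx => ⟨0, A.zero_mem, by simpa using hx⟩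
  | @step B B' s e b h he hb hΦ hB ih =>
    subst hB
    intro x hx
    obtain ⟨x, hxB, c, rfl⟩ := mem_sup_span_singleton_iff.mp hx
    -- The term `f • e` produces the coefficient `c` of `e`, up to the error `σ f • (Φ e - b • e)`,
    -- which lies in `B` and is absorbed by induction.
    obtain ⟨f, rfl⟩ := hs b (by simp) c
    obtain ⟨y, hy, hyA⟩ := ih (fun b' hb' => hs b' (by simp [hb'])) (x - σ f • (Φ e - b • e))
      (sub_mem hxB (B.smul_mem _ hΦ))
    refine ⟨y + f • e, mem_sup_span_singleton_iff.mpr ⟨y, hy, f, rfl⟩, ?_⟩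
    convert hyA using 1
    rw [map_add, LinearMap.map_smulₛₗ, smul_sub, sub_smul, mul_comm b, mul_smul, mul_smul, smul_add]
    abel

/-- As `e` lies outside `B`, adjoining it at both ends makes no step collapse. This shifts the upper
tower when a vector is attached to its base during reordering. -/
theorem sup_span_singleton (h : Tower Φ A B s) {e : V} {a : k} (he : e ∉ B)
    (hΦ : Φ e - a • e ∈ A) :
    Tower Φ (A ⊔ Submodule.span k {e}) (B ⊔ Submodule.span k {e}) s := by
  induction h with
  | refl hA =>
    refine .refl fun x hx => ?_
    obtain ⟨b, hb, c, rfl⟩ := mem_sup_span_singleton_iff.mp hx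
    refine mem_sup_span_singleton_iff.mpr
      ⟨Φ b + σ c • (Φ e - a • e), add_mem (hA b hb) (Submodule.smul_mem _ _ hΦ), σ c * a, ?_⟩
    rw [map_add, LinearMap.map_smulₛₗ, smul_sub, mul_smul]
    abel
  | @step B B' s e' b h he' hb hΦ' hB ih =>
    subst hB
    refine .step e' b (ih fun h' => he (Submodule.mem_sup_left h')) ?_ hb
      (Submodule.mem_sup_left hΦ') (sup_right_comm _ _ _)
    intro h'
    obtain ⟨x, hx, c, rfl⟩ := mem_sup_span_singleton_iff.mp h'
    by_cases hc : c = 0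
    · exact he' (by simpa [hc] using hx)
    · refine he ((Submodule.smul_mem_iff _ hc).mp ?_)
      exact mem_sup_span_singleton_iff.mpr ⟨-x, neg_mem hx, 1, by simp⟩

/-- Reordering of a tower: the scalars satisfying `p` can be moved to the bottom if the relevant
scalar equations are solvable. -/
theorem exists_filter (p : k → Prop) [DecidablePred p] (h : Tower Φ A B s)
    (hs : ∀ a ∈ s, p a → ∀ b ∈ s, ¬ p b → ∀ c, ∃ f, b * σ f - a * f = c) :
    ∃ P, Tower Φ A P (s.filter p) ∧ Tower Φ P B (s.filter fun a => ¬ p a) := by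
  induction h with
  | refl hA => exact ⟨A, by simpa using .refl hA, by simpa using .refl hA⟩
  | @step B B' s e a h he ha hΦ hB ih =>
    subst hB
    obtain ⟨P, h₁, h₂⟩ := ih fun a ha hp b hb => hs a (by simp [ha]) hp b (by simp [hb])
    by_cases hp : p a
    · rw [Multiset.filter_cons_of_pos _ hp, Multiset.filter_cons_of_neg (p := fun a => ¬ p a) _ (not_not.mpr hp)]
      -- Here `y` corrects the defect of `e` modulo `P`. The vector `e - y` generates the same top
      -- quotient and can already be attached to `P`.
      obtain ⟨y, hy, hyP⟩ := h₂.exists_solution (a := a) (fun b hb => by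
        rw [Multiset.mem_filter] at hb
        exact hs a (by simp) hp b (by simp [hb.1]) hb.2) _ hΦ
      have hey : e - y ∉ B := fun h' => he (by simpa using add_mem h' hy)
      have hΦ' : Φ (e - y) - a • (e - y) ∈ P := by
        have : Φ (e - y) - a • (e - y) = -(Φ y - a • y - (Φ e - a • e)) := by
          rw [map_sub, smul_sub]; abel
        rw [this]
        exact neg_mem hyP
      have hB : B ⊔ Submodule.span k {e} = B ⊔ Submodule.span k {e - y} := by
        apply le_antisymm <;> rw [sup_le_iff, Submodule.span_singleton_le_iff_mem] <;>
          refine ⟨le_sup_left, mem_sup_span_singleton_iff.mpr ?_⟩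
        · exact ⟨y, hy, 1, by simp⟩
        · exact ⟨-y, neg_mem hy, 1, by rw [one_smul]; abel⟩
      rw [hB]
      exact ⟨_, .step _ a h₁ (fun h' => hey (h₂.le h')) ha hΦ' rfl,
        h₂.sup_span_singleton hey hΦ'⟩
    · rw [Multiset.filter_cons_of_neg _ hp, Multiset.filter_cons_of_pos (p := fun a => ¬ p a) _ hp]
      exact ⟨P, h₁, .step e a h₂ he ha hΦ rfl⟩

/-- If the scalars from `A` to `P` are never equivalent to those from `P` to `B`, then `P` contains
every stable subspace with the former scalars. -/
theorem le_of_disjoint {Γ : Type*} {w : k → Γ} (hw : IsGaugeInvariant σ w) {P P' : Submodule k V}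
    {t : Multiset k} (h : Tower Φ P B s) (h' : Tower Φ A P' t) (hA : A ≤ P) (hB : P' ≤ B)
    (hst : ∀ a ∈ s, ∀ b ∈ t, w a ≠ w b) : P' ≤ P := by
  -- A tower from `P` to `P' ⊔ P` can be extracted with scalars among `t`, and another with scalars
  -- among `s`. Jordan–Hölder makes both empty.
  obtain ⟨t₁, t₂, rfl, -, h₂⟩ := h'.exists_inf_sup h.stable_bot
  rw [sup_eq_right.mpr hA] at h₂
  obtain ⟨s₁, s₂, rfl, h₁, -⟩ := h.exists_add h₂.stable le_sup_right (sup_le hB h.le)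
  have heq := h₁.map_eq_map hw h₂
  have h0 : s₁ = 0 := by
    refine Multiset.eq_zero_of_forall_notMem fun a ha => ?_
    obtain ⟨b, hb, hab⟩ := Multiset.mem_map.mp (heq ▸ Multiset.mem_map_of_mem w ha)
    exact hst a (by simp [ha]) b (by simp [hb]) hab.symm
  subst h0
  rw [h₁.eq_of_zero]
  exact le_sup_left

end Tower

end Tower

/-! ### Towers and triangularisations. -/

section TowerTriangularisation

variable {k : Type*} [Field k] {σ : k →+* k} {V : Type*} [AddCommGroup V] [Module k V]
  {Φ : V →ₛₗ[σ] V}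

theorem univ_val_map_castSucc {α : Type*} {n : ℕ} (a : Fin (n + 1) → α) :
    Finset.univ.val.map a =
      a (Fin.last n) ::ₘ Finset.univ.val.map fun i : Fin n => a i.castSucc := by
  rw [Fin.univ_castSuccEmb, Finset.cons_val, Multiset.map_cons, Finset.map_val, Multiset.map_map]
  rfl

theorem Tower.of_steps {n : ℕ} {F : Fin (n + 1) → Submodule k V} {a : Fin n → k}
    (h0 : ∀ x ∈ F 0, Φ x ∈ F 0) (ha : ∀ i, a i ≠ 0)
    (hF : ∀ i : Fin n, ∃ e, e ∉ F i.castSucc ∧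
      F i.succ = F i.castSucc ⊔ Submodule.span k {e} ∧ Φ e - a i • e ∈ F i.castSucc) :
    Tower Φ (F 0) (F (Fin.last n)) (Finset.univ.val.map a) := by
  induction n with
  | zero => simpa using Tower.refl h0
  | succ n ih =>
    obtain ⟨e, he, hB, hΦ⟩ := hF (Fin.last n)
    rw [univ_val_map_castSucc]
    refine .step e _ (ih (F := fun i => F i.castSucc) (a := fun i => a i.castSucc) h0
      (fun i => ha _) fun i => ?_) he (ha _) hΦ hB
    exact hF i.castSucc

theorem IsTriangularisation.tower {n : ℕ} {F : Fin (n + 1) → Submodule k V} {a : Fin n → k}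
    (h : IsTriangularisation Φ F a) : Tower Φ ⊥ ⊤ (Finset.univ.val.map a) := by
  rw [← h.bot, ← h.top]
  exact Tower.of_steps (fun x hx => (h.isSubmodule 0 x).mpr hx) h.ne_zero h.step

theorem Tower.exists_steps {A B : Submodule k V} {s : Multiset k} (h : Tower Φ A B s)
    (hB : IsSubmodule Φ B) :
    ∃ (n : ℕ) (F : Fin (n + 1) → Submodule k V) (a : Fin n → k), F 0 = A ∧ F (Fin.last n) = B ∧
      (∀ i, IsSubmodule Φ (F i)) ∧ (∀ i : Fin n, ∃ e, e ∉ F i.castSucc ∧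
      F i.succ = F i.castSucc ⊔ Submodule.span k {e} ∧ Φ e - a i • e ∈ F i.castSucc) ∧
      Finset.univ.val.map a = s := by
  induction h with
  | refl hA => exact ⟨0, fun _ => A, Fin.elim0, rfl, rfl, fun _ => hB, fun i => i.elim0, rfl⟩
  | @step B B' s e b h he hb hΦ hB' ih =>
    obtain ⟨n, F, a, h0, hn, hsub, hstep, hs⟩ :=
      ih (Tower.isSubmodule_of_step h.stable he hb hΦ (hB' ▸ hB))
    refine ⟨n + 1, Fin.snoc F B', Fin.snoc a b, ?_, ?_, ?_, ?_, ?_⟩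
    · have := Fin.snoc_castSucc (α := fun _ => Submodule k V) B' F 0
      rwa [h0] at this
    · exact Fin.snoc_last (α := fun _ => Submodule k V) B' F
    · intro i
      induction i using Fin.lastCases with
      | last => simpa using hB
      | cast i => simpa using hsub i
    · intro i
      induction i using Fin.lastCases with
      | last => exact ⟨e, by simpa [hn] using ⟨he, hB', hΦ⟩⟩
      | cast i =>
        obtain ⟨e, he⟩ := hstep i
        refine ⟨e, ?_⟩
        simp only [Fin.succ_castSucc, Fin.snoc_castSucc]
        exact he
    · rw [univ_val_map_castSucc]
      simp [hs]

theorem Tower.exists_isTriangularisation {s : Multiset k} (h : Tower Φ ⊥ ⊤ s) :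
    ∃ (n : ℕ) (F : Fin (n + 1) → Submodule k V) (a : Fin n → k), IsTriangularisation Φ F a ∧
      Finset.univ.val.map a = s := by
  obtain ⟨n, F, a, h0, hn, hsub, hstep, hs⟩ := h.exists_steps fun x => by simp
  exact ⟨n, F, a, ⟨h0, hn, hsub, fun i => h.ne_zero _ (hs ▸ by simp), hstep⟩, hs⟩

end TowerTriangularisation

/-! ### The Newton function read on the multiset of slopes of a tower. -/

section Newton

variable {b : BaseField} {q : ℂˣ} (ρ : CompatibleRoots q)
  {M : Type*} [AddCommGroup M] [Module b.K M]

/-- The slope attached to a scalar of `K_l`. -/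
noncomputable def BaseField.Ramified.slope {b : BaseField} {l : ℕ+} (a : b.Ramified l) : ℚ :=
  (a.val : ℚ) / ((l : ℕ) : ℚ)

theorem card_subtype_eq_count {α : Type*} {n : ℕ} (a : Fin n → α) (w : α → ℚ) (μ : ℚ) :
    Nat.card {i : Fin n // w (a i) = μ} = ((Finset.univ.val.map a).map w).count μ := by
  classical
  rw [Multiset.map_map, Multiset.count, Multiset.countP_map, Nat.card_eq_fintype_card,
    Fintype.card_subtype]
  simp only [Finset.card_def, Finset.filter_val, Function.comp, eq_comm]

theorem isNewtonFunction_iff {Φ : M →ₛₗ[b.sigma q] M} {r : ℚ → ℕ} :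
    IsNewtonFunction ρ Φ r ↔ ∃ (l : ℕ+) (s : Multiset (b.Ramified l)),
      Tower (ramifiedOp ρ Φ l) ⊥ ⊤ s ∧
        ∀ μ, r μ = (s.map BaseField.Ramified.slope).count μ := by
  constructor
  · rintro ⟨l, n, F, a, h, hr⟩
    refine ⟨l, _, h.tower, fun μ => ?_⟩
    rw [hr, ← card_subtype_eq_count]
    rfl
  · rintro ⟨l, s, h, hr⟩
    obtain ⟨n, F, a, hF, rfl⟩ := h.exists_isTriangularisation
    refine ⟨l, n, F, a, hF, fun μ => ?_⟩
    rw [hr, ← card_subtype_eq_count]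
    rfl

end Newton

/-! ### Coefficient recursions and their convergence. -/

section Convergence

open PowerSeries

/-- Summability at a single `z ≠ 0` bounds the terms, hence the coefficients by a geometric sequence
of ratio `‖z‖⁻¹`. -/
theorem HasLaurentExpansion.exists_norm_coeff_le {g : ℂ → ℂ} {x : PowerSeries ℂ}
    (h : HasLaurentExpansion g (HahnSeries.ofPowerSeries ℤ ℂ x)) :
    ∃ C R : ℝ, 0 < R ∧ ∀ n, ‖coeff n x‖ ≤ C * R ^ n := by
  obtain ⟨z, hz, h0⟩ := (h.and self_mem_nhdsWithin).exists
  have h0 : z ≠ 0 := h0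
  have hs : Summable fun n : ℕ => coeff n x * z ^ n := by
    refine (hz.summable.comp_injective (Nat.cast_injective (R := ℤ))).congr fun n => ?_
    simp only [Function.comp, zpow_natCast]
    rw [HahnSeries.ofPowerSeries_apply_coeff]
  refine ⟨∑' n, ‖coeff n x * z ^ n‖, ‖z‖⁻¹, by simpa using h0, fun n => ?_⟩
  have := hs.norm.le_tsum n fun _ _ => norm_nonneg _
  rw [norm_mul, norm_pow] at this
  rw [inv_pow, ← div_eq_mul_inv, le_div_iff₀ (pow_pos (norm_pos_iff.mpr h0) n)]
  simpa using this

theorem HasLaurentExpansion.exists_of_norm_coeff_le {x : PowerSeries ℂ} {C R : ℝ} (hR : 0 < R)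
    (h : ∀ n, ‖coeff n x‖ ≤ C * R ^ n) :
    ∃ g, HasLaurentExpansion g (HahnSeries.ofPowerSeries ℤ ℂ x) := by
  refine ⟨fun z => ∑' n : ℕ, coeff n x * z ^ n, ?_⟩
  have hb : ∀ᶠ z in 𝓝 (0 : ℂ), ‖z‖ < R⁻¹ := by
    filter_upwards [Metric.ball_mem_nhds (0 : ℂ) (inv_pos.mpr hR)] with z hz using by simpa using hz
  filter_upwards [nhdsWithin_le_nhds hb] with z hz
  have hs : Summable fun n : ℕ => coeff n x * z ^ n := by
    refine Summable.of_norm_bounded (g := fun n => C * (R * ‖z‖) ^ n)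
      ((summable_geometric_of_lt_one (by positivity) ?_).mul_left C) fun n => ?_
    · rw [← mul_inv_cancel₀ hR.ne']
      exact mul_lt_mul_of_pos_left hz hR
    · rw [norm_mul, norm_pow, mul_pow, ← mul_assoc]
      exact mul_le_mul_of_nonneg_right (h n) (by positivity)
  have hinj : Function.Injective fun n : ℕ => (n : ℤ) := Nat.cast_injective
  rw [← hinj.hasSum_iff]
  · refine HasLaurentExpansion.hasSum_of_eq (fun n => ?_) hs.hasSum
    simp only [Function.comp, zpow_natCast]
    rw [HahnSeries.ofPowerSeries_apply_coeff]
  · intro n hn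
    rw [HahnSeries.ofPowerSeries_apply, HahnSeries.embDomain_of_notMem_range, zero_mul]
    simpa using hn

/-- Since `U` has no constant term, the right side involves only coefficients of `x` of index below
`n`. The weights `α` and `γ` accommodate both forms of the equation: powers of `c` dividing the sum,
or multiplying the unknown. -/
theorem exists_powerSeries_recursion (α γ : ℕ → ℂ) (U G : PowerSeries ℂ) (hU : coeff 0 U = 0) :
    ∃ x : PowerSeries ℂ, ∀ n, coeff n x = α n * (coeff n G +
      ∑ p ∈ Finset.HasAntidiagonal.antidiagonal n, coeff p.1 U * (γ p.2 * coeff p.2 x)) := by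
  let F : (n : ℕ) → ((m : ℕ) → m < n → ℂ) → ℂ := fun n y => α n * (coeff n G +
    ∑ p ∈ Finset.HasAntidiagonal.antidiagonal n,
      if h : p.2 < n then coeff p.1 U * (γ p.2 * y p.2 h) else 0)
  refine ⟨PowerSeries.mk (wellFounded_lt.fix F), fun n => ?_⟩
  rw [coeff_mk, WellFounded.fix_eq]
  refine congrArg (fun t => α n * (coeff n G + t)) (Finset.sum_congr rfl fun p hp => ?_)
  rw [Finset.HasAntidiagonal.mem_antidiagonal] at hp
  split_ifs with h
  · rw [coeff_mk]
  · have : p.1 = 0 := by omega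
    rw [this, hU, zero_mul]

/-- The decay of `c⁻¹ ^ n` outweighs the `n + 1` terms of the convolution. -/
theorem exists_norm_coeff_le_of_recursion {c d : ℂ} (hc : 1 < ‖c‖) {U G x : PowerSeries ℂ}
    (hU0 : coeff 0 U = 0) (hU : ∃ C R : ℝ, 0 < R ∧ ∀ n, ‖coeff n U‖ ≤ C * R ^ n)
    (hG : ∃ C R : ℝ, 0 < R ∧ ∀ n, ‖coeff n G‖ ≤ C * R ^ n)
    (hx : ∀ n, coeff n x = d * c⁻¹ ^ n * (coeff n G +
      ∑ p ∈ Finset.HasAntidiagonal.antidiagonal n, coeff p.1 U * coeff p.2 x)) :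
    ∃ C R : ℝ, 0 < R ∧ ∀ n, ‖coeff n x‖ ≤ C * R ^ n := by
  obtain ⟨A, R₁, hR₁, hU⟩ := hU
  obtain ⟨B, R₂, hR₂, hG⟩ := hG
  have hA0 : 0 ≤ A := by simpa using (norm_nonneg _).trans (hU 0)
  have hB0 : 0 ≤ B := by simpa using (norm_nonneg _).trans (hG 0)
  set R := max R₁ R₂
  have hR : 0 < R := lt_max_of_lt_left hR₁
  replace hU : ∀ n, ‖coeff n U‖ ≤ A * R ^ n := fun n => (hU n).trans
    (mul_le_mul_of_nonneg_left (pow_le_pow_left₀ hR₁.le (le_max_left _ _) n) hA0)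
  replace hG : ∀ n, ‖coeff n G‖ ≤ B * R ^ n := fun n => (hG n).trans
    (mul_le_mul_of_nonneg_left (pow_le_pow_left₀ hR₂.le (le_max_right _ _) n) hB0)
  have hr : ‖c⁻¹‖ < 1 := by rw [norm_inv]; exact inv_lt_one_of_one_lt₀ hc
  have hlim1 : Tendsto (fun n : ℕ => ‖d‖ * ‖c⁻¹‖ ^ n) atTop (𝓝 0) := by
    simpa using (tendsto_pow_atTop_nhds_zero_of_lt_one (norm_nonneg _) hr).const_mul ‖d‖
  have hlim2 : Tendsto (fun n : ℕ => ‖d‖ * ‖c⁻¹‖ ^ n * ((n + 1) * A)) atTop (𝓝 0) := by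
    have h1 := ((tendsto_self_mul_const_pow_of_lt_one (norm_nonneg _) hr).const_mul
      (‖d‖ * A)).add (hlim1.mul_const A)
    simp only [mul_zero, zero_mul, add_zero] at h1
    refine h1.congr fun n => ?_
    ring
  obtain ⟨N, hN⟩ := ((hlim1.eventually_le_const one_pos).and
    (hlim2.eventually_le_const (half_pos one_pos))).exists_forall_of_atTop
  -- The sum handles the indices below `N`. Beyond `N` the recursion gives the bound `B + D / 2`,
  -- and `2 * B ≤ D` makes it at most `D`.
  set D := 2 * B + ∑ j ∈ Finset.range N, ‖coeff j x‖ / R ^ j with hD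
  have hsum0 : 0 ≤ ∑ j ∈ Finset.range N, ‖coeff j x‖ / R ^ j :=
    Finset.sum_nonneg fun _ _ => by positivity
  refine ⟨D, R, hR, fun n => ?_⟩
  induction n using Nat.strong_induction_on with
  | _ n ih =>
    rcases lt_or_ge n N with h | h
    · rw [← div_le_iff₀ (pow_pos hR n)]
      have := Finset.single_le_sum (f := fun j => ‖coeff j x‖ / R ^ j)
        (fun _ _ => by positivity) (Finset.mem_range.mpr h)
      linarith
    · obtain ⟨h1, h2⟩ := hN n h
      have hs : ‖∑ p ∈ Finset.HasAntidiagonal.antidiagonal n, coeff p.1 U * coeff p.2 x‖ ≤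
          (n + 1) * (A * D * R ^ n) := by
        refine (norm_sum_le_of_le (f := fun p : ℕ × ℕ => coeff p.1 U * coeff p.2 x)
          (n := fun _ => A * D * R ^ n) _ fun p hp => ?_).trans ?_
        · rw [Finset.HasAntidiagonal.mem_antidiagonal] at hp
          by_cases h0 : p.1 = 0
          · rw [h0, hU0, zero_mul, norm_zero]
            positivity
          · rw [norm_mul]
            calc ‖coeff p.1 U‖ * ‖coeff p.2 x‖ ≤ (A * R ^ p.1) * (D * R ^ p.2) :=
                  mul_le_mul (hU _) (ih p.2 (by omega)) (norm_nonneg _) (by positivity)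
              _ = A * D * R ^ n := by rw [← hp, pow_add]; ring
        · simp
      have hD0 : 0 ≤ D := by positivity
      rw [hx, norm_mul, norm_mul, norm_pow]
      calc ‖d‖ * ‖c⁻¹‖ ^ n * ‖coeff n G +
            ∑ p ∈ Finset.HasAntidiagonal.antidiagonal n, coeff p.1 U * coeff p.2 x‖
          ≤ ‖d‖ * ‖c⁻¹‖ ^ n * (B * R ^ n + (n + 1) * (A * D * R ^ n)) :=
            mul_le_mul_of_nonneg_left ((norm_add_le _ _).trans (add_le_add (hG n) hs))
              (by positivity)
        _ = (‖d‖ * ‖c⁻¹‖ ^ n) * (B * R ^ n) +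
              (‖d‖ * ‖c⁻¹‖ ^ n * ((n + 1) * A)) * (D * R ^ n) := by ring
        _ ≤ 1 * (B * R ^ n) + (1 / 2) * (D * R ^ n) := by gcongr
        _ = (B + D / 2) * R ^ n := by ring
        _ ≤ D * R ^ n := by gcongr; linarith

end Convergence

/-! ### Solving the scalar equation in the three base fields. -/

section ScalarEquation

open PowerSeries

theorem HasLaurentExpansion.eventuallyEq {g h : ℂ → ℂ} {f : ℂ⸨X⸩} (hg : HasLaurentExpansion g f)
    (hh : HasLaurentExpansion h f) : g =ᶠ[𝓝[≠] (0 : ℂ)] h := by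
  filter_upwards [hg, hh] with z h1 h2 using h1.unique h2

theorem laurentScale_ofPowerSeries (c : ℂˣ) (x : PowerSeries ℂ) :
    laurentScale c (HahnSeries.ofPowerSeries ℤ ℂ x) =
      HahnSeries.ofPowerSeries ℤ ℂ (rescale (c : ℂ) x) := by
  ext n
  rw [laurentScale_coeff]
  by_cases hn : n ∈ Set.range ((↑) : ℕ → ℤ)
  · obtain ⟨n, rfl⟩ := hn
    rw [HahnSeries.ofPowerSeries_apply_coeff, HahnSeries.ofPowerSeries_apply_coeff, coeff_rescale,
      zpow_natCast]
  · rw [HahnSeries.ofPowerSeries_apply, HahnSeries.ofPowerSeries_apply,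
      HahnSeries.embDomain_of_notMem_range, HahnSeries.embDomain_of_notMem_range, mul_zero] <;>
      simpa using hn

theorem laurentScale_single (c : ℂˣ) (m : ℤ) :
    laurentScale c (HahnSeries.single m 1) = HahnSeries.single m ((c : ℂ) ^ m) := by
  ext n
  rw [laurentScale_coeff]
  by_cases h : n = m
  · subst h; simp
  · rw [HahnSeries.coeff_single_of_ne h, HahnSeries.coeff_single_of_ne h, mul_zero]

theorem laurentScale_single_mul_ofPowerSeries (c : ℂˣ) (m : ℤ) (x : PowerSeries ℂ) :
    laurentScale c (HahnSeries.single m 1 * HahnSeries.ofPowerSeries ℤ ℂ x) =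
      HahnSeries.single m 1 *
        HahnSeries.ofPowerSeries ℤ ℂ (PowerSeries.C ((c : ℂ) ^ m) * rescale (c : ℂ) x) := by
  rw [map_mul, laurentScale_ofPowerSeries, laurentScale_single, map_mul, ← mul_assoc,
    HahnSeries.ofPowerSeries_C]
  congr 1
  rw [HahnSeries.C_apply, HahnSeries.single_mul_single, add_zero, one_mul]

theorem exists_ofPowerSeries_of_order_pos {u : ℂ⸨X⸩} (hu : 0 < u.order) :
    ∃ U : PowerSeries ℂ, u = HahnSeries.ofPowerSeries ℤ ℂ U ∧ coeff 0 U = 0 := by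
  have h : u = HahnSeries.ofPowerSeries ℤ ℂ (X ^ u.order.toNat * LaurentSeries.powerSeriesPart u) := by
    rw [map_mul, HahnSeries.ofPowerSeries_X_pow, Int.toNat_of_nonneg hu.le]
    exact (LaurentSeries.single_order_mul_powerSeriesPart u).symm
  refine ⟨_, h, ?_⟩
  rw [← HahnSeries.ofPowerSeries_apply_coeff (Γ := ℤ), ← h]
  exact HahnSeries.coeff_eq_zero_of_lt_order hu

theorem single_mem_convergent (m : ℤ) :
    HahnSeries.single m (1 : ℂ) ∈ BaseField.convergent.toSubfield :=
  ⟨_, HasLaurentExpansion.single m⟩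

/-- With `f = z ^ m * x` and `m = g.order`, comparing coefficients expresses `c ^ (m + n) * xₙ`
through earlier ones. Dividing by `c ^ n` is what preserves convergence. -/
theorem exists_scale_eq_mul_add {c : ℂˣ} (hc : 1 < ‖(c : ℂ)‖) {u : ℂ⸨X⸩} (hu : 0 < u.order)
    (g : ℂ⸨X⸩) : ∃ f, laurentScale c f = u * f + g ∧
      (u ∈ BaseField.convergent.toSubfield → g ∈ BaseField.convergent.toSubfield →
        f ∈ BaseField.convergent.toSubfield) := by
  obtain ⟨U, rfl, hU⟩ := exists_ofPowerSeries_of_order_pos hu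
  have hg := LaurentSeries.single_order_mul_powerSeriesPart g
  set m := g.order
  set G := LaurentSeries.powerSeriesPart g
  obtain ⟨x, hx⟩ := exists_powerSeries_recursion
    (fun n => ((c : ℂ) ^ m)⁻¹ * (c : ℂ)⁻¹ ^ n) (fun _ => 1) U G hU
  simp only [one_mul] at hx
  have hm : (c : ℂ) ^ m ≠ 0 := zpow_ne_zero _ c.ne_zero
  refine ⟨HahnSeries.single m 1 * HahnSeries.ofPowerSeries ℤ ℂ x, ?_, fun hu' hg' => ?_⟩
  · have key : PowerSeries.C ((c : ℂ) ^ m) * rescale (c : ℂ) x = U * x + G := by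
      ext n
      rw [coeff_C_mul, coeff_rescale, map_add, coeff_mul, hx, inv_pow]
      have hn : (c : ℂ) ^ n ≠ 0 := pow_ne_zero _ c.ne_zero
      field_simp
      ring
    rw [laurentScale_single_mul_ofPowerSeries, key, map_add, map_mul, ← hg]
    ring
  · refine mul_mem (single_mem_convergent m) ?_
    obtain ⟨_, hu'⟩ := hu'
    have hG : HahnSeries.ofPowerSeries ℤ ℂ G ∈ BaseField.convergent.toSubfield := by
      have : HahnSeries.ofPowerSeries ℤ ℂ G = HahnSeries.single (-m) 1 * g := by
        rw [← hg, ← mul_assoc, HahnSeries.single_mul_single]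
        simp
      rw [this]
      exact mul_mem (single_mem_convergent _) hg'
    obtain ⟨_, hG⟩ := hG
    obtain ⟨C, R, hR, h⟩ := exists_norm_coeff_le_of_recursion hc hU hu'.exists_norm_coeff_le
      hG.exists_norm_coeff_le hx
    exact HasLaurentExpansion.exists_of_norm_coeff_le hR h

/-- The same recursion now multiplies by powers of `c`. For `|c| > 1` these grow, so the solution is
only formal. -/
theorem exists_eq_mul_scale_add (c : ℂˣ) {u : ℂ⸨X⸩} (hu : 0 < u.order) (g : ℂ⸨X⸩) :
    ∃ f, f = u * laurentScale c f + g := by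
  obtain ⟨U, rfl, hU⟩ := exists_ofPowerSeries_of_order_pos hu
  have hg := LaurentSeries.single_order_mul_powerSeriesPart g
  set m := g.order
  set G := LaurentSeries.powerSeriesPart g
  obtain ⟨x, hx⟩ := exists_powerSeries_recursion
    (fun _ => 1) (fun n => (c : ℂ) ^ m * (c : ℂ) ^ n) U G hU
  refine ⟨HahnSeries.single m 1 * HahnSeries.ofPowerSeries ℤ ℂ x, ?_⟩
  have key : x = U * (PowerSeries.C ((c : ℂ) ^ m) * rescale (c : ℂ) x) + G := by
    ext n
    rw [hx, map_add, coeff_mul, one_mul, add_comm]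
    simp only [coeff_C_mul, coeff_rescale, mul_assoc]
  rw [laurentScale_single_mul_ofPowerSeries, ← hg]
  conv_lhs => rw [key, map_add, map_mul]
  ring

theorem compl_zero_mem_nhdsNE (z₀ : ℂ) : ({0}ᶜ : Set ℂ) ∈ 𝓝[≠] z₀ := by
  by_cases h : z₀ = 0
  · rw [h]; exact self_mem_nhdsWithin
  · exact nhdsWithin_le_nhds (isOpen_compl_singleton.mem_nhds h)

/-- A convergent solution of a first order `q`-difference equation with coefficients meromorphic on
the plane is meromorphic on the plane. -/
theorem mem_meromorphic_of_scale_eq {c : ℂˣ} (hc : 1 < ‖(c : ℂ)‖) {u g f : ℂ⸨X⸩}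
    (hu : u ∈ BaseField.meromorphic.toSubfield) (hg : g ∈ BaseField.meromorphic.toSubfield)
    (hf : f ∈ BaseField.convergent.toSubfield) (h : laurentScale c f = u * f + g) :
    f ∈ BaseField.meromorphic.toSubfield := by
  obtain ⟨U, hUm, hU⟩ := hu
  obtain ⟨G, hGm, hG⟩ := hg
  obtain ⟨F₀, hF₀⟩ := hf
  have hc0 : 0 < ‖(c : ℂ)‖ := one_pos.trans hc
  have heq := (h ▸ hF₀.scale c.ne_zero (laurentScale_coeff c f)).eventuallyEq ((hU.mul hF₀).add hG)
  obtain ⟨ρ, hρ, hball⟩ := Metric.mem_nhds_iff.mp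
    (eventually_nhdsWithin_iff.mp (heq.and hF₀.meromorphicAt.eventually_analyticAt))
  have hfe : ∀ z, z ≠ 0 → ‖z‖ < ρ → F₀ (c * z) = U z * F₀ z + G z := fun z h0 hz =>
    (hball (by simpa using hz) h0).1
  have han : ∀ z, ‖z‖ < ρ → MeromorphicAt F₀ z := fun z hz => by
    by_cases h0 : z = 0
    · exact h0 ▸ hF₀.meromorphicAt
    · exact (hball (by simpa using hz) h0).2.meromorphicAt
  -- `F k` continues `F₀` to the disc of radius `ρ * ‖c‖ ^ k` by applying `f(z) = u(z/c) f(z/c) +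
  -- g(z/c)` `k` times. Agreement is claimed only off `0`, where the expansion says nothing about
  -- the value of `F₀`.
  let F : ℕ → ℂ → ℂ := fun k => Nat.rec F₀
    (fun _ F z => U ((c : ℂ)⁻¹ * z) * F ((c : ℂ)⁻¹ * z) + G ((c : ℂ)⁻¹ * z)) k
  have hF1 : ∀ k z, F (k + 1) z =
    U ((c : ℂ)⁻¹ * z) * F k ((c : ℂ)⁻¹ * z) + G ((c : ℂ)⁻¹ * z) := fun _ _ => rfl
  have hnorm : ∀ z (k : ℕ), ‖z‖ < ρ * ‖(c : ℂ)‖ ^ (k + 1) →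
      ‖(c : ℂ)⁻¹ * z‖ < ρ * ‖(c : ℂ)‖ ^ k := fun z k hz => by
    rw [norm_mul, norm_inv, inv_mul_lt_iff₀ hc0]
    calc _ < _ := hz
      _ = _ := by ring
  have hmer : ∀ k z, ‖z‖ < ρ * ‖(c : ℂ)‖ ^ k → MeromorphicAt (F k) z := by
    intro k
    induction k with
    | zero => exact fun z hz => han z (by simpa using hz)
    | succ k ih =>
      intro z hz
      have hcomp : ∀ {P : ℂ → ℂ}, MeromorphicAt P ((c : ℂ)⁻¹ * z) →
          MeromorphicAt (fun z => P ((c : ℂ)⁻¹ * z)) z := fun hP =>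
        hP.comp_analyticAt (g := fun z => (c : ℂ)⁻¹ * z) (by fun_prop)
      exact ((hcomp (hUm _)).mul (hcomp (ih _ (hnorm z k hz)))).add (hcomp (hGm _))
  have hstep : ∀ k z, z ≠ 0 → ‖z‖ < ρ * ‖(c : ℂ)‖ ^ k → F (k + 1) z = F k z := by
    intro k
    induction k with
    | zero =>
      intro z h0 hz
      have h1 : ‖(c : ℂ)⁻¹ * z‖ < ρ := by
        rw [norm_mul, norm_inv, inv_mul_lt_iff₀ hc0]
        rw [pow_zero, mul_one] at hz
        nlinarith
      have := hfe _ (mul_ne_zero (inv_ne_zero c.ne_zero) h0) h1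
      rw [mul_inv_cancel_left₀ c.ne_zero] at this
      exact this.symm
    | succ k ih =>
      intro z h0 hz
      rw [hF1 (k + 1), ih _ (mul_ne_zero (inv_ne_zero c.ne_zero) h0) (hnorm z k hz)]
  have hmono : ∀ k m z, z ≠ 0 → ‖z‖ < ρ * ‖(c : ℂ)‖ ^ k → F (k + m) z = F k z := by
    intro k m z h0 hz
    induction m with
    | zero => rfl
    | succ m ih =>
      rw [← add_assoc, hstep _ z h0 (hz.trans_le ?_), ih]
      exact mul_le_mul_of_nonneg_left (pow_le_pow_right₀ hc.le (Nat.le_add_right _ _)) hρ.le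
  have hex : ∀ z : ℂ, ∃ k : ℕ, ‖z‖ < ρ * ‖(c : ℂ)‖ ^ k := fun z => by
    obtain ⟨k, hk⟩ := pow_unbounded_of_one_lt (‖z‖ / ρ) hc
    exact ⟨k, by rwa [div_lt_iff₀' hρ] at hk⟩
  choose κ hκ using hex
  have hFκ : ∀ k z, z ≠ 0 → ‖z‖ < ρ * ‖(c : ℂ)‖ ^ k → F k z = F (κ z) z := by
    intro k z h0 hz
    rcases le_total k (κ z) with hk | hk <;> obtain ⟨m, hm⟩ := Nat.exists_eq_add_of_le hk
    · rw [hm, hmono k m z h0 hz]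
    · rw [hm, hmono _ m z h0 (hκ z)]
  have hev : ∀ k z, ‖z‖ < ρ * ‖(c : ℂ)‖ ^ k → F k =ᶠ[𝓝[≠] z] fun z => F (κ z) z := by
    intro k z hz
    filter_upwards [compl_zero_mem_nhdsNE z,
      nhdsWithin_le_nhds (continuous_norm.continuousAt.eventually_lt_const hz)] with y h0 hy
    exact hFκ k y h0 hy
  exact ⟨fun z => F (κ z) z, fun z => (hmer _ z (hκ z)).congr (hev _ z (hκ z)),
    hF₀.congr (hev 0 0 (by simpa using hρ))⟩

theorem BaseField.meromorphic_le_convergent :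
    BaseField.meromorphic.toSubfield ≤ BaseField.convergent.toSubfield :=
  fun _ ⟨g, _, h⟩ => ⟨g, h⟩

theorem order_div {a b : ℂ⸨X⸩} (ha : a ≠ 0) (hb : b ≠ 0) : (a / b).order = a.order - b.order := by
  have := HahnSeries.order_mul (div_ne_zero ha hb) hb
  rw [div_mul_cancel₀ _ hb] at this
  omega

/-- Solvability of the scalar equation `β σ(f) - a f = g` in `K`. -/
theorem BaseField.exists_mul_sigma_sub_mul_eq {b : BaseField} {c : ℂˣ} (hc : 1 < ‖(c : ℂ)‖)
    {a β : b.K} (ha : a ≠ 0) (hβ : β ≠ 0) (h : BaseField.val a ≠ BaseField.val β)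
    (h' : b ≠ .formal → BaseField.val β < BaseField.val a) (g : b.K) :
    ∃ f, β * b.sigma c f - a * f = g := by
  obtain ⟨a, ham⟩ := a
  obtain ⟨β, hβm⟩ := β
  obtain ⟨g, hgm⟩ := g
  replace ha : a ≠ 0 := fun h0 => ha (Subtype.ext h0)
  replace hβ : β ≠ 0 := fun h0 => hβ (Subtype.ext h0)
  suffices ∃ f ∈ b.toSubfield, β * laurentScale c f - a * f = g by
    obtain ⟨f, hf, heq⟩ := this
    exact ⟨⟨f, hf⟩, Subtype.ext heq⟩
  change a.order ≠ β.order at h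
  change b ≠ .formal → β.order < a.order at h'
  -- Dividing by the coefficient of smaller valuation makes the ratio `u` of positive order; the
  -- second case occurs only for formal series.
  by_cases hlt : β.order < a.order
  · have hu : 0 < (a / β).order := by rw [order_div ha hβ]; omega
    obtain ⟨f, hf, hf'⟩ := exists_scale_eq_mul_add hc hu (g / β)
    have hum := div_mem ham hβm
    have hgm' := div_mem hgm hβm
    refine ⟨f, ?_, by rw [hf]; field_simp; ring⟩
    match b with
    | meromorphic =>
      exact mem_meromorphic_of_scale_eq hc hum hgm'
        (hf' (meromorphic_le_convergent hum) (meromorphic_le_convergent hgm')) hf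
    | convergent => exact hf' hum hgm'
    | formal => exact Subfield.mem_top _
  · have hb : b = .formal := by
      by_contra hb
      exact hlt (h' hb)
    subst hb
    have hu : 0 < (β / a).order := by rw [order_div hβ ha]; omega
    obtain ⟨f, hf⟩ := exists_eq_mul_scale_add c hu (-g / a)
    refine ⟨f, Subfield.mem_top _, ?_⟩
    have : a * f = β * laurentScale c f - g := by
      conv_lhs => rw [hf]
      field_simp
      ring
    rw [this]
    ring

end ScalarEquation

/-! ### Elements of `K_l` invariant under `z_l ↦ ζ z_l`. -/

section Ramification

/-- Invariance forces `ζ ^ n = 1` whenever the `n`-th coefficient is nonzero, so only multiples of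
`l` occur as exponents. -/
theorem exists_laurentRamify_eq {l : ℕ+} {ζ : ℂˣ} (hζ : IsPrimitiveRoot ζ l) {f : ℂ⸨X⸩}
    (hf : laurentScale ζ f = f) : ∃ h, laurentRamify l h = f ∧ ∀ n, h.coeff n = f.coeff (l * n) := by
  have hl : (1 : ℤ) ≤ (l : ℕ) := by exact_mod_cast l.pos
  have hb : ∀ n : ℤ, n < min f.order 0 → f.coeff (((l : ℕ) : ℤ) * n) = 0 := fun n hn => by
    refine HahnSeries.coeff_eq_zero_of_lt_order ?_
    have h1 : n < f.order := hn.trans_le (min_le_left _ _)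
    have h2 : n < 0 := hn.trans_le (min_le_right _ _)
    nlinarith
  have hB : BddBelow (Function.support fun n : ℤ => f.coeff (((l : ℕ) : ℤ) * n)) :=
    ⟨min f.order 0, fun n hn => not_lt.mp fun h => hn (hb n h)⟩
  refine ⟨HahnSeries.ofSuppBddBelow _ hB, ?_, fun n => rfl⟩
  ext n
  by_cases hn : n ∈ Set.range fun k : ℤ => ((l : ℕ) : ℤ) * k
  · obtain ⟨k, rfl⟩ := hn
    simp only [laurentRamify_coeff_mul]
    rfl
  · rw [laurentRamify_coeff_of_notMem l _ n hn]
    by_contra h0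
    have h1 : (ζ : ℂ) ^ n = 1 := by
      have := congrArg (fun f => f.coeff n) hf
      simp only [laurentScale_coeff] at this
      exact (mul_eq_right₀ (Ne.symm h0)).mp this
    have h2 : ζ ^ n = 1 := by
      ext
      simpa using h1
    obtain ⟨k, hk⟩ := (hζ.zpow_eq_one_iff_dvd n).mp h2
    exact hn ⟨k, hk.symm⟩

/-- The discontinuity of the principal root is harmless: the expansion is an identity point by
point, and only `w ^ (1 / l) → 0` is needed. -/
theorem HasLaurentExpansion.comp_cpow {l : ℕ+} {g : ℂ → ℂ} {f h : ℂ⸨X⸩}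
    (hg : HasLaurentExpansion g f) (hf : laurentRamify l h = f) :
    HasLaurentExpansion (fun w => g (w ^ ((l : ℕ) : ℂ)⁻¹)) h := by
  have hl : (0 : ℝ) < (((l : ℕ) : ℂ)⁻¹).re := by
    rw [← Complex.ofReal_natCast, ← Complex.ofReal_inv, Complex.ofReal_re]
    exact inv_pos.mpr (by exact_mod_cast l.pos)
  have ht : Tendsto (fun w : ℂ => w ^ ((l : ℕ) : ℂ)⁻¹) (𝓝[≠] 0) (𝓝[≠] 0) := by
    refine tendsto_nhdsWithin_iff.mpr ⟨?_, ?_⟩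
    · have := Complex.continuousAt_cpow_const_of_re_pos (z := 0) (Or.inl le_rfl) hl
      refine Tendsto.mono_left ?_ nhdsWithin_le_nhds
      have h0 : (0 : ℂ) ^ ((l : ℕ) : ℂ)⁻¹ = 0 := Complex.zero_cpow (by
        intro h0; rw [h0] at hl; simp at hl)
      simpa [ContinuousAt, h0] using this
    · filter_upwards [self_mem_nhdsWithin] with w hw h0
      exact hw (Complex.cpow_eq_zero_iff _ _ |>.mp h0).1
  have hinj : Function.Injective fun k : ℤ => ((l : ℕ) : ℤ) * k :=
    mul_right_injective₀ (by exact_mod_cast l.ne_zero)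
  filter_upwards [ht.eventually hg] with w hw
  subst hf
  rw [← hinj.hasSum_iff (fun n hn => by rw [laurentRamify_coeff_of_notMem l h n hn, zero_mul])] at hw
  refine hasSum_of_eq (fun n => ?_) hw
  simp only [Function.comp, laurentRamify_coeff_mul]
  rw [zpow_mul, zpow_natCast, Complex.cpow_nat_inv_pow _ l.ne_zero]

/-- The series controls `g` only near `0`; averaging over the powers of `ζ` makes the invariance
hold at every point without changing the expansion. -/
theorem exists_invariant_of_laurentScale_eq {l : ℕ+} {ζ : ℂˣ} (hζ : ζ ^ (l : ℕ) = 1) {g : ℂ → ℂ}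
    (hg : Meromorphic g) {f : ℂ⸨X⸩} (hgf : HasLaurentExpansion g f) (hf : laurentScale ζ f = f) :
    ∃ g', Meromorphic g' ∧ HasLaurentExpansion g' f ∧ ∀ z, g' (ζ * z) = g' z := by
  have hpow : ∀ j : ℕ, ∀ n, f.coeff n = (((ζ ^ j : ℂˣ) : ℂ)) ^ n * f.coeff n := fun j n => by
    induction j with
    | zero => simp
    | succ j ih =>
      have := congrArg (fun f => f.coeff n) hf
      simp only [laurentScale_coeff] at this
      rw [pow_succ, Units.val_mul, mul_zpow, mul_assoc, this, ← ih]
  have hmer : ∀ m : ℕ, Meromorphic fun z => ∑ j ∈ Finset.range m, g ((ζ ^ j : ℂˣ) * z) := by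
    intro m x
    refine MeromorphicAt.fun_sum fun j _ => ?_
    exact (hg _).comp_analyticAt (g := fun z => ((ζ ^ j : ℂˣ) : ℂ) * z) (by fun_prop)
  have hexp : ∀ m : ℕ, HasLaurentExpansion (fun z => ∑ j ∈ Finset.range m, g ((ζ ^ j : ℂˣ) * z))
      (m • f) := by
    intro m
    induction m with
    | zero => simpa [Pi.zero_def] using HasLaurentExpansion.zero
    | succ m ih =>
      rw [succ_nsmul]
      refine (ih.add (hgf.scale (ζ ^ m : ℂˣ).ne_zero (hpow m))).congr ?_
      exact Eventually.of_forall fun z => by simp [Finset.sum_range_succ]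
  have hl : ((l : ℕ) : ℂ) ≠ 0 := by exact_mod_cast l.ne_zero
  refine ⟨fun z => ((l : ℕ) : ℂ)⁻¹ * ∑ j ∈ Finset.range l, g ((ζ ^ j : ℂˣ) * z), ?_, ?_, ?_⟩
  · exact fun x => (MeromorphicAt.const _ x).mul (hmer l x)
  · filter_upwards [hexp l] with z hz
    refine HasLaurentExpansion.hasSum_of_eq (fun n => ?_) (hz.mul_left ((l : ℕ) : ℂ)⁻¹)
    rw [HahnSeries.coeff_nsmul, Pi.smul_apply, nsmul_eq_mul]
    field_simp
  · intro z
    refine congrArg (((l : ℕ) : ℂ)⁻¹ * ·) ?_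
    have h1 : ∀ j : ℕ, g ((ζ ^ j : ℂˣ) * (ζ * z)) = g ((ζ ^ (j + 1) : ℂˣ) * z) := fun j => by
      rw [pow_succ, Units.val_mul, mul_assoc]
    simp only [h1]
    have h2 := Finset.sum_range_succ (fun j => g ((ζ ^ j : ℂˣ) * z)) l
    rw [Finset.sum_range_succ', hζ, pow_zero] at h2
    exact add_right_cancel h2

/-- An element of `K_l` fixed by the Galois group lies in `K`. -/
theorem BaseField.exists_ramify_eq {b : BaseField} {l : ℕ+} {ζ : ℂˣ} (hζ : IsPrimitiveRoot ζ l)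
    {f : b.K} (hf : b.sigma ζ f = f) : ∃ h, b.ramify l h = f := by
  obtain ⟨f, hfm⟩ := f
  replace hf : laurentScale ζ f = f := congrArg Subtype.val hf
  obtain ⟨h, hh, -⟩ := exists_laurentRamify_eq hζ hf
  suffices h ∈ b.toSubfield from ⟨⟨h, this⟩, Subtype.ext hh⟩
  match b with
  | formal => exact Subfield.mem_top _
  | convergent =>
    obtain ⟨g, hg⟩ := hfm
    exact ⟨_, hg.comp_cpow hh⟩
  | meromorphic =>
    obtain ⟨g₀, hg₀, hgf₀⟩ := hfm
    obtain ⟨g, hg, hgf, hinv⟩ := exists_invariant_of_laurentScale_eq hζ.pow_eq_one hg₀ hgf₀ hf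
    have hinv' : ∀ (j : ℕ) z, g ((ζ : ℂ) ^ j * z) = g z := fun j z => by
      induction j with
      | zero => simp
      | succ j ih => rw [pow_succ', mul_assoc, hinv, ih]
    have hroot : ∀ x y : ℂ, x ^ (l : ℕ) = y ^ (l : ℕ) → g x = g y := by
      intro x y hxy
      by_cases hy : y = 0
      · subst hy
        rw [zero_pow l.ne_zero] at hxy
        rw [pow_eq_zero_iff l.ne_zero |>.mp hxy]
      · have h1 : (x / y) ^ (l : ℕ) = 1 := by
          rw [div_pow, hxy, div_self (pow_ne_zero _ hy)]
        have hζ' : IsPrimitiveRoot (ζ : ℂ) l := IsPrimitiveRoot.coe_units_iff.mpr hζ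
        obtain ⟨j, -, hj⟩ := hζ'.eq_pow_of_pow_eq_one h1
        rw [← hinv' j y, hj, div_mul_cancel₀ _ hy]
    refine ⟨_, fun w₀ => ?_, hgf.comp_cpow hh⟩
    by_cases h0 : w₀ = 0
    · exact h0 ▸ (hgf.comp_cpow hh).meromorphicAt
    -- By invariance the choice of root does not affect the value, so the principal branch is
    -- replaced by one analytic at `w₀`.
    · have h1 : (fun w : ℂ => g (w ^ ((l : ℕ) : ℂ)⁻¹)) =
          fun w => g (w₀ ^ ((l : ℕ) : ℂ)⁻¹ * (w / w₀) ^ ((l : ℕ) : ℂ)⁻¹) := by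
        funext w
        refine hroot _ _ ?_
        rw [mul_pow, Complex.cpow_nat_inv_pow _ l.ne_zero, Complex.cpow_nat_inv_pow _ l.ne_zero,
          Complex.cpow_nat_inv_pow _ l.ne_zero, mul_div_cancel₀ _ h0]
      rw [h1]
      refine (hg _).comp_analyticAt
        (g := fun w : ℂ => w₀ ^ ((l : ℕ) : ℂ)⁻¹ * (w / w₀) ^ ((l : ℕ) : ℂ)⁻¹) ?_
      refine analyticAt_const.mul (AnalyticAt.cpow (analyticAt_id.div_const) analyticAt_const ?_)
      simp [div_self h0]

end Ramification

/-! ### Extension of scalars and Galois descent. -/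

section ScalarExtension

variable {K A A' : Type*} [Field K] [Field A] [Field A'] [Algebra K A] [Algebra K A']
  {M : Type*} [AddCommGroup M] [Module K M]

/-- The semilinear map `A ⊗ M → A' ⊗ M` induced by `τ : A → A'`. -/
noncomputable def scalarMap (M : Type*) [AddCommGroup M] [Module K M] (τ : A →ₐ[K] A') :
    A ⊗[K] M →ₛₗ[(τ : A →+* A')] A' ⊗[K] M where
  toFun := LinearMap.rTensor M τ.toLinearMap
  map_add' := map_add _
  map_smul' c x := by
    induction x with
    | zero => simp
    | add x y hx hy => rw [smul_add, map_add, hx, hy, map_add, smul_add]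
    | tmul x m => simp [TensorProduct.smul_tmul']

@[simp]
theorem scalarMap_tmul (τ : A →ₐ[K] A') (x : A) (m : M) : scalarMap M τ (x ⊗ₜ m) = τ x ⊗ₜ m := rfl

/-- A linear form vanishing on `C` but not at `e` extends to `A' ⊗ M`, and `τ` is injective. This is
the independence that `Tower.map` requires. -/
theorem mem_of_scalarMap_mem_span (τ : A →ₐ[K] A') (C : Submodule A (A ⊗[K] M)) (e : A ⊗[K] M)
    (he : scalarMap M τ e ∈ Submodule.span A' (scalarMap M τ '' C)) : e ∈ C := by
  by_contra hC
  obtain ⟨φ, hφ, hle⟩ := Submodule.exists_le_ker_of_notMem hC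
  let ψ : A' ⊗[K] M →ₗ[A'] A' := LinearMap.liftBaseChange A'
    (τ.toLinearMap ∘ₗ φ.restrictScalars K ∘ₗ TensorProduct.mk K A M 1)
  have key : ∀ x, ψ (scalarMap M τ x) = τ (φ x) := fun x => by
    induction x with
    | zero => simp
    | add x y hx hy => rw [map_add, map_add, hx, hy, map_add, map_add]
    | tmul x m =>
      have : x ⊗ₜ[K] m = x • (1 : A) ⊗ₜ[K] m := by rw [TensorProduct.smul_tmul', smul_eq_mul, mul_one]
      conv_rhs => rw [this, map_smul, smul_eq_mul, map_mul]
      simp [ψ]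
  have h1 : Submodule.span A' (scalarMap M τ '' C) ≤ LinearMap.ker ψ := by
    rw [Submodule.span_le]
    rintro _ ⟨x, hx, rfl⟩
    rw [SetLike.mem_coe, LinearMap.mem_ker, key, LinearMap.mem_ker.mp (hle hx), map_zero]
  have h2 := LinearMap.mem_ker.mp (h1 he)
  rw [key] at h2
  exact hφ ((map_eq_zero τ).mp h2)

theorem span_scalarMap_top (τ : A →ₐ[K] A') :
    Submodule.span A' (scalarMap M τ '' (⊤ : Submodule A (A ⊗[K] M))) = ⊤ := by
  rw [eq_top_iff]
  rintro x -
  induction x with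
  | zero => exact zero_mem _
  | add x y hx hy => exact add_mem hx hy
  | tmul x m =>
    have : x ⊗ₜ[K] m = x • scalarMap M τ (1 ⊗ₜ m) := by
      rw [scalarMap_tmul, map_one, TensorProduct.smul_tmul', smul_eq_mul, mul_one]
    rw [this]
    exact Submodule.smul_mem _ _ (Submodule.subset_span ⟨_, trivial, rfl⟩)

/-- In a basis coming from `M`, the map acts coordinatewise by `τ`, so each coordinate is fixed. -/
theorem exists_eq_one_tmul_of_scalarMap_eq {τ : A →ₐ[K] A}
    (hτ : ∀ a, τ a = a → ∃ c, algebraMap K A c = a) {x : A ⊗[K] M} (hx : scalarMap M τ x = x) :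
    ∃ m : M, x = 1 ⊗ₜ m := by
  classical
  let B := Module.Basis.ofVectorSpace K M
  let BA := Algebra.TensorProduct.basis A B
  have key : ∀ y i, BA.repr (scalarMap M τ y) i = τ (BA.repr y i) := fun y i => by
    induction y with
    | zero => simp
    | add x y hx hy => rw [map_add, map_add, Finsupp.add_apply, hx, hy, map_add, Finsupp.add_apply,
        map_add]
    | tmul a m => simp [BA, Algebra.TensorProduct.basis_repr_tmul]
  have h1 : ∀ i, ∃ c, algebraMap K A c = BA.repr x i := fun i => hτ _ (by rw [← key, hx])
  choose c hc using h1
  refine ⟨∑ i ∈ (BA.repr x).support, c i • B i, ?_⟩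
  conv_lhs => rw [← BA.linearCombination_repr x]
  rw [Finsupp.linearCombination_apply, Finsupp.sum, TensorProduct.tmul_sum]
  refine Finset.sum_congr rfl fun i _ => ?_
  rw [← hc i, Algebra.TensorProduct.basis_apply, TensorProduct.tmul_smul, algebraMap_smul]

/-- Galois descent for a Kummer extension. -/
theorem mem_span_one_tmul_of_stable {l : ℕ} (hl : (l : A) ≠ 0) {τ : A →ₐ[K] A} (hτl : τ ^ l = 1)
    {z : A} (hz : z ≠ 0) (hzl : τ (z ^ l) = z ^ l) (hzj : ∀ j, 0 < j → j < l → (τ ^ j) z ≠ z)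
    (hτ : ∀ a, τ a = a → ∃ c, algebraMap K A c = a) {P : Submodule A (A ⊗[K] M)}
    (hP : ∀ x ∈ P, scalarMap M τ x ∈ P) {x : A ⊗[K] M} (hx : x ∈ P) :
    x ∈ Submodule.span A ((fun m : M => (1 : A) ⊗ₜ[K] m) '' {m | (1 : A) ⊗ₜ[K] m ∈ P}) := by
  have hsucc : ∀ j x, scalarMap M (τ ^ (j + 1)) x = scalarMap M τ (scalarMap M (τ ^ j) x) :=
    fun j x => by
      induction x with
      | zero => simp
      | add x y hx hy => simp only [map_add, hx, hy]
      | tmul a m => simp [pow_succ']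
  have hone : ∀ x, scalarMap M (1 : A →ₐ[K] A) x = x := fun x => by
    induction x with
    | zero => simp
    | add x y hx hy => rw [map_add, hx, hy]
    | tmul a m => simp
  have hmem : ∀ j, ∀ x ∈ P, scalarMap M (τ ^ j) x ∈ P := fun j x hx => by
    induction j with
    | zero => rwa [pow_zero, hone]
    | succ j ih => rw [hsucc]; exact hP _ ih
  -- The traces `y i` are fixed by `τ`, hence come from `M`. They recover `x` through `∑ z ^ i • y i
  -- = l • x`: for `0 < j < l` the ratio `z / τ ^ j z` is an `l`-th root of unity other than `1`, so
  -- its geometric sum vanishes.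
  let y : ℕ → A ⊗[K] M := fun i => ∑ j ∈ Finset.range l, scalarMap M (τ ^ j) (z⁻¹ ^ i • x)
  have hyP : ∀ i, y i ∈ P := fun i => sum_mem fun j _ => hmem j _ (P.smul_mem _ hx)
  have hyf : ∀ i, scalarMap M τ (y i) = y i := fun i => by
    have h2 := Finset.sum_range_succ (fun j => scalarMap M (τ ^ j) (z⁻¹ ^ i • x)) l
    rw [Finset.sum_range_succ', hτl, pow_zero] at h2
    simp only [y, map_sum, ← hsucc]
    exact add_right_cancel h2
  have hyS : ∀ i, y i ∈
      Submodule.span A ((fun m : M => (1 : A) ⊗ₜ[K] m) '' {m | (1 : A) ⊗ₜ[K] m ∈ P}) := fun i => by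
    obtain ⟨m, hm⟩ := exists_eq_one_tmul_of_scalarMap_eq hτ (hyf i)
    rw [hm]
    exact Submodule.subset_span ⟨m, show (1 : A) ⊗ₜ[K] m ∈ P from hm ▸ hyP i, rfl⟩
  have hzjl : ∀ j, (τ ^ j) (z ^ l) = z ^ l := fun j => by
    induction j with
    | zero => simp
    | succ j ih => rw [pow_succ', AlgHom.mul_apply, ih, hzl]
  have hgeom : ∀ j ∈ Finset.range l, j ≠ 0 →
      ∑ i ∈ Finset.range l, (z * (τ ^ j) z⁻¹) ^ i = 0 := fun j hj hj0 => by
    have h1 : z * (τ ^ j) z⁻¹ ≠ 1 := by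
      rw [map_inv₀, ← div_eq_mul_inv, Ne, div_eq_one_iff_eq ((map_ne_zero _).mpr hz)]
      exact fun h => hzj j (Nat.pos_of_ne_zero hj0) (Finset.mem_range.mp hj) h.symm
    have h2 := mul_geom_sum (z * (τ ^ j) z⁻¹) l
    rw [mul_pow, ← map_pow, inv_pow, map_inv₀ _ (z ^ l), hzjl, mul_inv_cancel₀ (pow_ne_zero _ hz),
      sub_self] at h2
    exact (mul_eq_zero.mp h2).resolve_left (sub_ne_zero.mpr h1)
  have hsum : ∑ i ∈ Finset.range l, z ^ i • y i = (l : A) • x := by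
    have h1 : ∀ i j, z ^ i • scalarMap M (τ ^ j) (z⁻¹ ^ i • x) =
        (z * (τ ^ j) z⁻¹) ^ i • scalarMap M (τ ^ j) x := fun i j => by
      rw [LinearMap.map_smulₛₗ, smul_smul, mul_pow]
      congr 2
      exact map_pow (τ ^ j) _ _
    simp only [y, Finset.smul_sum, h1]
    rw [Finset.sum_comm]
    simp only [← Finset.sum_smul]
    rw [Finset.sum_eq_single_of_mem 0]
    · rw [pow_zero, hone]
      simp only [AlgHom.one_apply, mul_inv_cancel₀ hz, one_pow, Finset.sum_const, Finset.card_range,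
        nsmul_one]
    · exact Finset.mem_range.mpr (Nat.pos_of_ne_zero fun h => hl (by simp [h]))
    · intro j hj hj0
      rw [hgeom j hj hj0, zero_smul]
  rw [← Submodule.smul_mem_iff _ hl, ← hsum]
  exact sum_mem fun i _ => Submodule.smul_mem _ _ (hyS i)

end ScalarExtension

/-! ### Valuations and slopes under scaling, ramification and Galois action. -/

section Valuation

theorem order_laurentScale (c : ℂˣ) (f : ℂ⸨X⸩) : (laurentScale c f).order = f.order := by
  by_cases hf : f = 0
  · simp [hf]
  have hf' : laurentScale c f ≠ 0 := (map_ne_zero _).mpr hf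
  apply le_antisymm <;> apply HahnSeries.order_le_of_coeff_ne_zero
  · rw [laurentScale_coeff]
    exact mul_ne_zero (zpow_ne_zero _ c.ne_zero) (HahnSeries.coeff_order_eq_zero.not.mpr hf)
  · exact fun h0 => HahnSeries.coeff_order_eq_zero.not.mpr hf' (by rw [laurentScale_coeff, h0, mul_zero])

theorem order_laurentRamify (l : ℕ+) (f : ℂ⸨X⸩) :
    (laurentRamify l f).order = (l : ℕ) * f.order := by
  by_cases hf : f = 0
  · simp [hf]
  have hf' : laurentRamify l f ≠ 0 := (map_ne_zero _).mpr hf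
  apply le_antisymm
  · apply HahnSeries.order_le_of_coeff_ne_zero
    rw [laurentRamify_coeff_mul]
    exact HahnSeries.coeff_order_eq_zero.not.mpr hf
  · have h0 := HahnSeries.coeff_order_eq_zero.not.mpr hf'
    have hmem : (laurentRamify l f).order ∈ Set.range fun k : ℤ => ((l : ℕ) : ℤ) * k := by
      by_contra hn
      exact h0 (laurentRamify_coeff_of_notMem l f _ hn)
    obtain ⟨k, hk⟩ := hmem
    simp only at hk
    rw [← hk, laurentRamify_coeff_mul] at h0
    rw [← hk]
    exact mul_le_mul_of_nonneg_left (HahnSeries.order_le_of_coeff_ne_zero h0) (by positivity)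

theorem laurentRamify_mul (l' l : ℕ+) (f : ℂ⸨X⸩) :
    laurentRamify l' (laurentRamify l f) = laurentRamify (l' * l) f := by
  ext n
  by_cases hn : n ∈ Set.range fun k : ℤ => ((l' : ℕ) : ℤ) * k
  · obtain ⟨k, rfl⟩ := hn
    rw [laurentRamify_coeff_mul]
    by_cases hk : k ∈ Set.range fun k : ℤ => ((l : ℕ) : ℤ) * k
    · obtain ⟨k, rfl⟩ := hk
      rw [laurentRamify_coeff_mul]
      simp only
      have := laurentRamify_coeff_mul (l' * l) f k
      rw [PNat.mul_coe, Nat.cast_mul, mul_assoc] at this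
      exact this.symm
    · rw [laurentRamify_coeff_of_notMem l f k hk, laurentRamify_coeff_of_notMem]
      rintro ⟨j, hj⟩
      refine hk ⟨j, ?_⟩
      simp only [PNat.mul_coe, Nat.cast_mul, mul_assoc] at hj
      exact mul_left_cancel₀ (by exact_mod_cast l'.ne_zero) hj
  · rw [laurentRamify_coeff_of_notMem l' _ n hn, laurentRamify_coeff_of_notMem]
    rintro ⟨j, hj⟩
    refine hn ⟨(l : ℕ) * j, ?_⟩
    simpa only [PNat.mul_coe, Nat.cast_mul, mul_assoc] using hj

namespace BaseField

theorem single_mem (b : BaseField) (m : ℤ) : HahnSeries.single m (1 : ℂ) ∈ b.toSubfield := by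
  match b with
  | meromorphic => exact ⟨_, fun x => (MeromorphicAt.id x).zpow m, .single m⟩
  | convergent => exact ⟨_, .single m⟩
  | formal => exact Subfield.mem_top _

namespace Ramified

variable {b : BaseField} {l : ℕ+}

theorem slope_sigma (c : ℂˣ) (a : b.Ramified l) : (Ramified.sigma b l c a).slope = a.slope := by
  have : (Ramified.sigma b l c a).val = a.val := order_laurentScale c _
  rw [slope, this, slope]

/-- Scaling preserves the order, so the gauge factor contributes equally to both sides.
Jordan–Hölder therefore applies to slopes. -/
theorem isGaugeInvariant_slope (c : ℂˣ) :
    Tower.IsGaugeInvariant (Ramified.sigma b l c) (slope (b := b) (l := l)) := by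
  rintro ⟨a, ham⟩ ⟨a', ham'⟩ ⟨x, hxm⟩ ha ha' hx h
  replace ha : a ≠ 0 := fun h0 => ha (Subtype.ext h0)
  replace ha' : a' ≠ 0 := fun h0 => ha' (Subtype.ext h0)
  replace hx : x ≠ 0 := fun h0 => hx (Subtype.ext h0)
  replace h : laurentScale c x * a = a' * x := congrArg Subtype.val h
  have h1 := congrArg HahnSeries.order h
  rw [HahnSeries.order_mul ((map_ne_zero _).mpr hx) ha, HahnSeries.order_mul ha' hx,
    order_laurentScale] at h1
  have h2 : a.order = a'.order := by omega
  change ((a.order : ℤ) : ℚ) / _ = ((a'.order : ℤ) : ℚ) / _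
  rw [h2]

/-- The inclusion `K_l ⊂ K_{l'l}`. -/
noncomputable def incl (b : BaseField) (l' l : ℕ+) : b.Ramified l →ₐ[b.K] b.Ramified (l' * l) where
  toRingHom := b.ramify l'
  commutes' f := Subtype.ext (laurentRamify_mul l' l f)

theorem slope_incl (l' : ℕ+) (a : b.Ramified l) : (incl b l' l a).slope = a.slope := by
  have : (incl b l' l a).val = (l' : ℕ) * a.val := order_laurentRamify l' _
  rw [slope, this, slope, PNat.mul_coe]
  have h1 : ((l' : ℕ) : ℚ) ≠ 0 := by exact_mod_cast l'.ne_zero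
  push_cast
  rw [mul_div_mul_left _ _ h1]

/-- The Galois automorphism `f(z_l) ↦ f(ζ z_l)` of `K_l` over `K`. -/
noncomputable def galois (b : BaseField) (l : ℕ+) (ζ : ℂˣ) (hζ : ζ ^ (l : ℕ) = 1) :
    b.Ramified l →ₐ[b.K] b.Ramified l where
  toRingHom := Ramified.sigma b l ζ
  commutes' f := by
    change Ramified.sigma b l ζ _ = _
    rw [sigma_algebraMap, hζ]
    congr 1
    refine Subtype.ext (HahnSeries.ext (funext fun n => ?_))
    change ((1 : ℂˣ) : ℂ) ^ n * _ = _
    simp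

theorem galois_pow_apply {ζ : ℂˣ} (hζ : ζ ^ (l : ℕ) = 1) (j : ℕ) (a : b.Ramified l) :
    (galois b l ζ hζ ^ j) a = Ramified.sigma b l (ζ ^ j) a := by
  induction j with
  | zero =>
    refine Subtype.ext (HahnSeries.ext (funext fun n => ?_))
    change _ = ((ζ ^ 0 : ℂˣ) : ℂ) ^ n * _
    simp
  | succ j ih =>
    rw [pow_succ', AlgHom.mul_apply, ih]
    refine Subtype.ext (HahnSeries.ext (funext fun n => ?_))
    change (ζ : ℂ) ^ n * (((ζ ^ j : ℂˣ) : ℂ) ^ n * _) = ((ζ ^ (j + 1) : ℂˣ) : ℂ) ^ n * _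
    rw [pow_succ', Units.val_mul, mul_zpow, mul_assoc]

theorem galois_pow_eq_one {ζ : ℂˣ} (hζ : ζ ^ (l : ℕ) = 1) : galois b l ζ hζ ^ (l : ℕ) = 1 := by
  ext a
  rw [galois_pow_apply, ← pow_zero ζ |>.trans hζ.symm, ← galois_pow_apply hζ, pow_zero]

/-- The coordinate `z_l`. -/
noncomputable def coord (b : BaseField) (l : ℕ+) : b.Ramified l :=
  (⟨HahnSeries.single 1 1, b.single_mem 1⟩ : b.K)

theorem coord_ne_zero : coord b l ≠ 0 := fun h => by
  have : HahnSeries.single (1 : ℤ) (1 : ℂ) = 0 := congrArg Subtype.val h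
  simp at this

theorem galois_coord_pow {ζ : ℂˣ} (hζ : ζ ^ (l : ℕ) = 1) :
    galois b l ζ hζ (coord b l ^ (l : ℕ)) = coord b l ^ (l : ℕ) := by
  refine Subtype.ext ?_
  change laurentScale ζ (HahnSeries.single 1 1 ^ (l : ℕ)) = HahnSeries.single 1 1 ^ (l : ℕ)
  rw [HahnSeries.single_pow, one_pow, laurentScale_single]
  congr 1
  rw [nsmul_eq_mul, mul_one, zpow_natCast, ← Units.val_pow_eq_pow_val, hζ, Units.val_one]

theorem galois_pow_coord_ne {ζ : ℂˣ} (hζ : IsPrimitiveRoot ζ l) {j : ℕ} (hj : 0 < j)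
    (hjl : j < l) : (galois b l ζ hζ.pow_eq_one ^ j) (coord b l) ≠ coord b l := by
  rw [galois_pow_apply]
  intro h
  have h1 : laurentScale (ζ ^ j) (HahnSeries.single 1 1) = HahnSeries.single 1 1 :=
    congrArg Subtype.val h
  rw [laurentScale_single, zpow_one] at h1
  have h2 := HahnSeries.single_injective _ h1
  exact hζ.pow_ne_one_of_pos_of_lt hj.ne' hjl (Units.ext h2)

theorem natCast_ne_zero {n : ℕ} (hn : n ≠ 0) : ((n : ℕ) : b.Ramified l) ≠ 0 := fun h => by
  have h1 : ((n : ℕ) : ℂ⸨X⸩) = 0 := congrArg Subtype.val h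
  have h2 : HahnSeries.C (Γ := ℤ) ((n : ℕ) : ℂ) = HahnSeries.C 0 := by
    rw [map_natCast, h1, map_zero]
  exact hn (by exact_mod_cast HahnSeries.C_injective h2)

end Ramified

end BaseField

end Valuation

/-! ### Uniqueness of the Newton function; submodules and quotients. -/

section RamifiedOp

variable {b : BaseField} {q : ℂˣ} (ρ : CompatibleRoots q)
  {M : Type*} [AddCommGroup M] [Module b.K M] {M' : Type*} [AddCommGroup M'] [Module b.K M']
  {Φ : M →ₛₗ[b.sigma q] M} {Φ' : M' →ₛₗ[b.sigma q] M'}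

theorem scalarMap_ramifiedOp {l l' : ℕ+} (τ : b.Ramified l →ₐ[b.K] b.Ramified l')
    (hτ : ∀ x, τ (BaseField.Ramified.sigma b l (ρ.root l) x) =
      BaseField.Ramified.sigma b l' (ρ.root l') (τ x)) (x : b.Ramified l ⊗[b.K] M) :
    scalarMap M τ (ramifiedOp ρ Φ l x) = ramifiedOp ρ Φ l' (scalarMap M τ x) := by
  induction x with
  | zero => simp
  | add x y hx hy => simp only [map_add, hx, hy]
  | tmul x m => simp [hτ]

theorem baseChange_ramifiedOp (u : M →ₗ[b.K] M') (hu : ∀ x, u (Φ x) = Φ' (u x)) (l : ℕ+)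
    (x : b.Ramified l ⊗[b.K] M) : u.baseChange (b.Ramified l) (ramifiedOp ρ Φ l x) =
      ramifiedOp ρ Φ' l (u.baseChange (b.Ramified l) x) := by
  induction x with
  | zero => simp
  | add x y hx hy => simp only [map_add, hx, hy]
  | tmul x m => simp [hu]

theorem BaseField.Ramified.galois_sigma {l : ℕ+} {ζ : ℂˣ} (hζ : ζ ^ (l : ℕ) = 1) (c : ℂˣ)
    (x : b.Ramified l) : galois b l ζ hζ (Ramified.sigma b l c x) =
      Ramified.sigma b l c (galois b l ζ hζ x) := by
  refine Subtype.ext (HahnSeries.ext (funext fun n => ?_))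
  exact mul_left_comm _ _ _

theorem BaseField.Ramified.incl_sigma (l' l : ℕ+) (x : b.Ramified l) :
    incl b l' l (Ramified.sigma b l (ρ.root l) x) =
      Ramified.sigma b (l' * l) (ρ.root (l' * l)) (incl b l' l x) := by
  have := b.sigma_ramify l' (ρ.root (l' * l)) x
  rw [ρ.root_mul_pow] at this
  exact this.symm

theorem Tower.exists_ramified_mul {l : ℕ+} {s : Multiset (b.Ramified l)}
    (h : Tower (ramifiedOp ρ Φ l) ⊥ ⊤ s) (l' : ℕ+) {L : ℕ+} (hL : L = l' * l) :
    ∃ t : Multiset (b.Ramified L), Tower (ramifiedOp ρ Φ L) ⊥ ⊤ t ∧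
      t.map BaseField.Ramified.slope = s.map BaseField.Ramified.slope := by
  subst hL
  have := h.map (scalarMap M (BaseField.Ramified.incl b l' l))
    (scalarMap_ramifiedOp ρ _ (BaseField.Ramified.incl_sigma ρ l' l))
    fun C _ x hx => mem_of_scalarMap_mem_span _ C x hx
  rw [span_scalarMap_top, Submodule.bot_coe, Set.image_singleton, map_zero,
    Submodule.span_zero_singleton] at this
  refine ⟨_, this, ?_⟩
  rw [Multiset.map_map]
  exact Multiset.map_congr rfl fun a _ => BaseField.Ramified.slope_incl l' a

theorem IsNewtonFunction.unique {r r' : ℚ → ℕ} (h : IsNewtonFunction ρ Φ r)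
    (h' : IsNewtonFunction ρ Φ r') : r = r' := by
  obtain ⟨l, s, hs, hr⟩ := (isNewtonFunction_iff ρ).mp h
  obtain ⟨l', s', hs', hr'⟩ := (isNewtonFunction_iff ρ).mp h'
  -- Both towers are compared over the common extension `K_{l'l}`.
  obtain ⟨t, ht, hts⟩ := hs.exists_ramified_mul ρ l' rfl
  obtain ⟨t', ht', hts'⟩ := hs'.exists_ramified_mul ρ l (mul_comm l' l)
  funext μ
  rw [hr, hr', ← hts, ← hts',
    ht.map_eq_map (BaseField.Ramified.isGaugeInvariant_slope _) ht']

theorem IsNewtonFunction.newtonFunction_eq {r : ℚ → ℕ} (h : IsNewtonFunction ρ Φ r) :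
    newtonFunction ρ Φ = r := by
  have hex : ∃ r, IsNewtonFunction ρ Φ r := ⟨r, h⟩
  rw [newtonFunction, dif_pos hex]
  exact hex.choose_spec.unique ρ h

/-- The default value `0`, taken when no triangularisation exists, has no slopes. One slope
therefore guarantees triangularisability after ramification. -/
theorem isNewtonFunction_newtonFunction {μ : ℚ} (h : μ ∈ slopes ρ Φ) :
    IsNewtonFunction ρ Φ (newtonFunction ρ Φ) := by
  by_cases hex : ∃ r, IsNewtonFunction ρ Φ r
  · rw [newtonFunction, dif_pos hex]
    exact hex.choose_spec
  · refine absurd ?_ h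
    rw [newtonFunction, dif_neg hex]
    rfl

theorem Tower.of_range_baseChange {i : M' →ₗ[b.K] M} (hi : Function.Injective i)
    (hΦ : ∀ x, i (Φ' x) = Φ (i x)) {l : ℕ+} {s : Multiset (b.Ramified l)}
    (h : Tower (ramifiedOp ρ Φ l) ⊥ (LinearMap.range (i.baseChange (b.Ramified l))) s) :
    Tower (ramifiedOp ρ Φ' l) ⊥ ⊤ s := by
  have h1 := h.comap (i.baseChange (b.Ramified l)) (baseChange_ramifiedOp ρ i hΦ l) le_rfl
  have hinj : Function.Injective (i.baseChange (b.Ramified l)) :=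
    Module.Flat.lTensor_preserves_injective_linearMap i hi
  rw [Submodule.comap_bot, LinearMap.ker_eq_bot.mpr hinj] at h1
  convert h1
  exact (eq_top_iff.mpr fun x _ => ⟨x, rfl⟩).symm

theorem Tower.of_ker_baseChange {p : M →ₗ[b.K] M'} (hp : Function.Surjective p)
    (hΦ : ∀ x, p (Φ x) = Φ' (p x)) {l : ℕ+} {s : Multiset (b.Ramified l)}
    (h : Tower (ramifiedOp ρ Φ l) (LinearMap.ker (p.baseChange (b.Ramified l))) ⊤ s) :
    Tower (ramifiedOp ρ Φ' l) ⊥ ⊤ s := by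
  have h1 := h.map_of_surjective (p.baseChange (b.Ramified l)) (baseChange_ramifiedOp ρ p hΦ l)
    le_rfl
  have hsurj : Function.Surjective (p.baseChange (b.Ramified l)) :=
    LinearMap.lTensor_surjective _ hp
  rw [Submodule.map_top, LinearMap.range_eq_top.mpr hsurj] at h1
  convert h1
  · exact (LinearMap.le_ker_iff_map.mp le_rfl).symm
  · simp

theorem IsNewtonFunction.of_injective {r : ℚ → ℕ} (h : IsNewtonFunction ρ Φ r)
    {i : M' →ₗ[b.K] M} (hi : Function.Injective i) (hΦ : ∀ x, i (Φ' x) = Φ (i x)) :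
    ∃ r', IsNewtonFunction ρ Φ' r' ∧ ∀ μ, r' μ ≤ r μ := by
  obtain ⟨l, s, hs, hr⟩ := (isNewtonFunction_iff ρ).mp h
  obtain ⟨s₁, s₂, rfl, h₁, -⟩ := hs.exists_add
    (W := LinearMap.range (i.baseChange (b.Ramified l))) (by
      rintro _ ⟨x, rfl⟩
      exact ⟨_, baseChange_ramifiedOp ρ i hΦ l x⟩) bot_le le_top
  refine ⟨_, (isNewtonFunction_iff ρ).mpr ⟨l, s₁, h₁.of_range_baseChange ρ hi hΦ, fun μ => rfl⟩,
    fun μ => ?_⟩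
  rw [hr, Multiset.map_add, Multiset.count_add]
  exact Nat.le_add_right _ _

theorem IsNewtonFunction.of_surjective {r : ℚ → ℕ} (h : IsNewtonFunction ρ Φ r)
    {p : M →ₗ[b.K] M'} (hp : Function.Surjective p) (hΦ : ∀ x, p (Φ x) = Φ' (p x)) :
    ∃ r', IsNewtonFunction ρ Φ' r' ∧ ∀ μ, r' μ ≤ r μ := by
  obtain ⟨l, s, hs, hr⟩ := (isNewtonFunction_iff ρ).mp h
  obtain ⟨s₁, s₂, rfl, -, h₂⟩ := hs.exists_add
    (W := LinearMap.ker (p.baseChange (b.Ramified l))) (by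
      intro x hx
      rw [LinearMap.mem_ker, baseChange_ramifiedOp ρ p hΦ, LinearMap.mem_ker.mp hx, map_zero])
    bot_le le_top
  refine ⟨_, (isNewtonFunction_iff ρ).mpr ⟨l, s₂, h₂.of_ker_baseChange ρ hp hΦ, fun μ => rfl⟩,
    fun μ => ?_⟩
  rw [hr, Multiset.map_add, Multiset.count_add]
  exact Nat.le_add_left _ _

theorem Tower.finrank_eq_card [FiniteDimensional b.K M] {l : ℕ+} {s : Multiset (b.Ramified l)}
    (h : Tower (ramifiedOp ρ Φ l) ⊥ ⊤ s) : Module.finrank b.K M = s.card := by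
  have := h.finrank_eq
  rwa [finrank_top, finrank_bot, zero_add, Module.finrank_baseChange] at this

theorem IsNewtonFunction.subsingleton [FiniteDimensional b.K M] (h : IsNewtonFunction ρ Φ 0) :
    Subsingleton M := by
  obtain ⟨l, s, hs, hr⟩ := (isNewtonFunction_iff ρ).mp h
  have h0 : s.map BaseField.Ramified.slope = 0 := by
    ext μ
    rw [← hr, Multiset.count_zero]
    rfl
  rw [Multiset.map_eq_zero] at h0
  rw [← Module.finrank_zero_iff (R := b.K), hs.finrank_eq_card ρ, h0, Multiset.card_zero]

end RamifiedOp

/-! ### Isolating the slope `μ`, descending to `K`, and maximality. -/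

section SlopeFiltration

variable {b : BaseField} {q : ℂˣ} (ρ : CompatibleRoots q)
  {M : Type*} [AddCommGroup M] [Module b.K M] {Φ : M →ₛₗ[b.sigma q] M}

theorem CompatibleRoots.one_lt_norm_root (hq : 1 < ‖(q : ℂ)‖) (l : ℕ+) :
    1 < ‖((ρ.root l : ℂˣ) : ℂ)‖ := by
  by_contra h
  have h1 := pow_le_one₀ (n := l) (norm_nonneg _) (not_lt.mp h)
  rw [← norm_pow, ← Units.val_pow_eq_pow_val, ρ.root_pow] at h1
  exact absurd hq (not_lt.mpr h1)

/-- Over `K_l`, the part of slope `μ` can be moved to the bottom of a tower. -/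
theorem Tower.exists_slope_filter (hq : 1 < ‖(q : ℂ)‖) {l : ℕ+} {s : Multiset (b.Ramified l)}
    (h : Tower (ramifiedOp ρ Φ l) ⊥ ⊤ s) (μ : ℚ)
    (hmax : b ≠ .formal → ∀ a ∈ s, a.slope ≤ μ) :
    ∃ P, Tower (ramifiedOp ρ Φ l) ⊥ P (s.filter fun a => a.slope = μ) ∧
      Tower (ramifiedOp ρ Φ l) P ⊤ (s.filter fun a => ¬ a.slope = μ) := by
  refine h.exists_filter _ fun a ha hμa β hβ hμβ c => ?_
  have hl : (0 : ℚ) < ((l : ℕ) : ℚ) := by exact_mod_cast l.pos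
  refine BaseField.exists_mul_sigma_sub_mul_eq (b := b) (ρ.one_lt_norm_root hq l)
    (h.ne_zero a ha) (h.ne_zero β hβ) (fun hv => hμβ ?_) (fun hb => ?_) c
  · have hv : a.val = β.val := hv
    rw [← hμa, BaseField.Ramified.slope, BaseField.Ramified.slope, hv]
  · have h1 : β.slope < a.slope := hμa ▸ lt_of_le_of_ne (hmax hb β hβ) hμβ
    rw [BaseField.Ramified.slope, BaseField.Ramified.slope, div_lt_div_iff_of_pos_right hl] at h1
    exact_mod_cast h1

/-- The part of slope `μ` over `K_l` is stable under the Galois group. -/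
theorem Tower.galois_mem {l : ℕ+} {s t : Multiset (b.Ramified l)}
    {P : Submodule (b.Ramified l) (b.Ramified l ⊗[b.K] M)}
    (h : Tower (ramifiedOp ρ Φ l) ⊥ P s) (h' : Tower (ramifiedOp ρ Φ l) P ⊤ t)
    (hst : ∀ a ∈ s, ∀ c ∈ t, a.slope ≠ c.slope) {ζ : ℂˣ} (hζ : ζ ^ (l : ℕ) = 1) :
    ∀ x ∈ P, scalarMap M (BaseField.Ramified.galois b l ζ hζ) x ∈ P := by
  have h1 := h.map (scalarMap M (BaseField.Ramified.galois b l ζ hζ))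
    (scalarMap_ramifiedOp ρ _ (BaseField.Ramified.galois_sigma hζ _))
    fun C _ x hx => mem_of_scalarMap_mem_span _ C x hx
  rw [Submodule.bot_coe, Set.image_singleton, map_zero, Submodule.span_zero_singleton] at h1
  -- The conjugate of `P` has the same slopes as `P`, none of which occurs above `P`.
  have h2 := Tower.le_of_disjoint (BaseField.Ramified.isGaugeInvariant_slope _) h' h1 bot_le le_top
    fun c hc a ha => by
      obtain ⟨a, ha', rfl⟩ := Multiset.mem_map.mp ha
      have : (BaseField.Ramified.galois b l ζ hζ a).slope = a.slope :=
        BaseField.Ramified.slope_sigma ζ a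
      exact fun he => hst a ha' c hc (this ▸ he.symm)
  exact fun x hx => h2 (Submodule.subset_span ⟨x, hx, rfl⟩)

/-- The part of slope `μ` over `K_l` is defined over `K`. -/
theorem Tower.exists_range_baseChange_eq {l : ℕ+} {s t : Multiset (b.Ramified l)}
    {P : Submodule (b.Ramified l) (b.Ramified l ⊗[b.K] M)}
    (h : Tower (ramifiedOp ρ Φ l) ⊥ P s) (h' : Tower (ramifiedOp ρ Φ l) P ⊤ t)
    (hst : ∀ a ∈ s, ∀ c ∈ t, a.slope ≠ c.slope) :
    ∃ N : Submodule b.K M, IsSubmodule Φ N ∧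
      LinearMap.range (N.subtype.baseChange (b.Ramified l)) = P := by
  let N : Submodule b.K M :=
    (P.restrictScalars b.K).comap (TensorProduct.mk b.K (b.Ramified l) M 1)
  have hN : ∀ m, m ∈ N ↔ (1 : b.Ramified l) ⊗ₜ[b.K] m ∈ P := fun m => Iff.rfl
  have hP : IsSubmodule (ramifiedOp ρ Φ l) P := h'.isSubmodule fun x => by simp
  refine ⟨N, fun m => ?_, le_antisymm ?_ fun x hx => ?_⟩
  · rw [hN, hN, ← hP (1 ⊗ₜ m), ramifiedOp_tmul, map_one]
  · rintro _ ⟨x, rfl⟩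
    induction x with
    | zero => simp
    | add x y hx hy => rw [map_add]; exact add_mem hx hy
    | tmul a m =>
      have : a ⊗ₜ[b.K] (m : M) = a • (1 : b.Ramified l) ⊗ₜ[b.K] (m : M) := by
        rw [TensorProduct.smul_tmul', smul_eq_mul, mul_one]
      rw [LinearMap.baseChange_tmul, Submodule.subtype_apply, this]
      exact P.smul_mem _ ((hN m).mp m.2)
  -- Only this inclusion needs descent; the coordinate `z_l` serves as Kummer generator.
  · have hζ₀ := Complex.isPrimitiveRoot_exp l l.ne_zero
    have hζ := hζ₀.isUnit_unit l.ne_zero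
    have h1 := mem_span_one_tmul_of_stable (BaseField.Ramified.natCast_ne_zero l.ne_zero)
      (BaseField.Ramified.galois_pow_eq_one hζ.pow_eq_one) BaseField.Ramified.coord_ne_zero
      (BaseField.Ramified.galois_coord_pow hζ.pow_eq_one)
      (fun j => BaseField.Ramified.galois_pow_coord_ne hζ)
      (fun a ha => BaseField.exists_ramify_eq hζ ha)
      (h.galois_mem ρ h' hst hζ.pow_eq_one) hx
    refine Submodule.span_le.mpr ?_ h1
    rintro _ ⟨m, hm, rfl⟩
    exact ⟨1 ⊗ₜ ⟨m, hm⟩, by simp⟩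

/-- The two halves of the reordered tower over `K_l` become towers for the base changes of `N` and
`M / N`, by flatness and right exactness of the tensor product. -/
theorem exists_slope_submodule (hq : 1 < ‖(q : ℂ)‖) [FiniteDimensional b.K M] {r : ℚ → ℕ}
    (hr : IsNewtonFunction ρ Φ r) (μ : ℚ) (hmax : b ≠ .formal → ∀ ν, r ν ≠ 0 → ν ≤ μ) :
    ∃ (N : Submodule b.K M) (hN : IsSubmodule Φ N), Module.finrank b.K N = r μ ∧
      IsNewtonFunction ρ (subOp Φ N hN) (fun ν => if ν = μ then r ν else 0) ∧
      IsNewtonFunction ρ (quotOp Φ N hN) (fun ν => if ν = μ then 0 else r ν) := by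
  obtain ⟨l, s, hs, hrs⟩ := (isNewtonFunction_iff ρ).mp hr
  obtain ⟨P, h₁, h₂⟩ := hs.exists_slope_filter ρ hq μ fun hb a ha => hmax hb _ <| by
    rw [hrs, Multiset.count_ne_zero]
    exact Multiset.mem_map_of_mem _ ha
  obtain ⟨N, hN, hNP⟩ := h₁.exists_range_baseChange_eq ρ h₂ fun a ha c hc h => by
    rw [Multiset.mem_filter] at ha hc
    exact hc.2 (h ▸ ha.2)
  have hsub : Tower (ramifiedOp ρ (subOp Φ N hN) l) ⊥ ⊤ (s.filter fun a => a.slope = μ) :=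
    Tower.of_range_baseChange ρ (i := N.subtype) N.injective_subtype (fun _ => rfl) (hNP ▸ h₁)
  have hker : LinearMap.ker (N.mkQ.baseChange (b.Ramified l)) = P := by
    rw [← hNP]
    have hex : Function.Exact N.subtype N.mkQ := LinearMap.exact_subtype_mkQ N
    exact LinearMap.exact_iff.mp (lTensor_exact (b.Ramified l) hex N.mkQ_surjective) |>
      fun h => SetLike.ext fun x => SetLike.ext_iff.mp h x
  have hquot : Tower (ramifiedOp ρ (quotOp Φ N hN) l) ⊥ ⊤ (s.filter fun a => ¬ a.slope = μ) :=
    Tower.of_ker_baseChange ρ (p := N.mkQ) N.mkQ_surjective (fun _ => rfl) (hker ▸ h₂)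
  have hmap : ∀ p : ℚ → Prop, ∀ [DecidablePred p], ∀ ν,
      ((s.filter fun a => p a.slope).map BaseField.Ramified.slope).count ν =
        if p ν then r ν else 0 := fun p _ ν => by
    have := Multiset.filter_map (p := p) (f := BaseField.Ramified.slope) s
    rw [hrs, ← Multiset.count_filter, this]
    rfl
  refine ⟨N, hN, ?_, (isNewtonFunction_iff ρ).mpr ⟨l, _, hsub, fun ν => ?_⟩,
    (isNewtonFunction_iff ρ).mpr ⟨l, _, hquot, fun ν => ?_⟩⟩
  · rw [hsub.finrank_eq_card ρ, hrs, Multiset.count, Multiset.countP_map]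
    simp only [eq_comm]
  · exact (hmap (fun ν => ν = μ) ν).symm
  · rw [hmap (fun ν => ¬ ν = μ) ν, ite_not]

/-- A submodule whose slopes are not slopes of the quotient by `N` is contained in `N`. -/
theorem le_of_slopes_disjoint [FiniteDimensional b.K M] {N N' : Submodule b.K M}
    (hN : IsSubmodule Φ N) (hN' : IsSubmodule Φ N') {r r' : ℚ → ℕ}
    (hr : IsNewtonFunction ρ (quotOp Φ N hN) r) (hr' : IsNewtonFunction ρ (subOp Φ N' hN') r')
    (h : ∀ ν, r ν = 0 ∨ r' ν = 0) : N' ≤ N := by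
  -- `N' / (N ∩ N')` is a quotient of `N'` and embeds in `M / N`, so its Newton function is bounded
  -- by both `r'` and `r`, and is zero.
  let C : Submodule b.K N' := N.comap N'.subtype
  have hC : IsSubmodule (subOp Φ N' hN') C := fun x => hN x
  obtain ⟨r₁, hr₁, hle₁⟩ := hr'.of_surjective ρ (Φ' := quotOp (subOp Φ N' hN') C hC)
    C.mkQ_surjective fun _ => rfl
  obtain ⟨r₂, hr₂, hle₂⟩ := hr.of_injective ρ (Φ' := quotOp (subOp Φ N' hN') C hC)
    (i := C.mapQ N N'.subtype le_rfl) (by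
      rw [← LinearMap.ker_eq_bot, Submodule.ker_mapQ, ← C.mkQ_map_self]) (fun x => by
      obtain ⟨x, rfl⟩ := C.mkQ_surjective x
      rfl)
  have h0 : r₁ = 0 := by
    funext ν
    rcases h ν with h | h
    · rw [hr₁.unique ρ hr₂]
      exact Nat.eq_zero_of_le_zero (h ▸ hle₂ ν)
    · exact Nat.eq_zero_of_le_zero (h ▸ hle₁ ν)
  subst h0
  have := hr₁.subsingleton ρ
  have hC : C = ⊤ := Submodule.Quotient.subsingleton_iff.mp this
  exact fun x hx => (hC ▸ Submodule.mem_top : (⟨x, hx⟩ : N') ∈ C)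

end SlopeFiltration

end QDiff

/-! ### The theorem. -/

theorem mainTheorem3 (q : ℂˣ) (hq : 1 < ‖(q : ℂ)‖) (ρ : QDiff.CompatibleRoots q)
    (b : QDiff.BaseField) {M : Type*} [AddCommGroup M] [Module b.K M] [FiniteDimensional b.K M]
    (Φ : M →ₛₗ[b.sigma q] M) (hΦ : Function.Bijective Φ)
    (μ : ℚ) (hμ : μ ∈ QDiff.slopes ρ Φ)
    (hmax : b ≠ QDiff.BaseField.formal → IsGreatest (QDiff.slopes ρ Φ) μ) :
    ∃ N : Submodule b.K M,
      IsGreatest {N' | QDiff.IsPureSubmodule ρ Φ μ N'} N ∧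
      Module.finrank b.K N = QDiff.newtonFunction ρ Φ μ ∧
      ∃ hN : QDiff.IsSubmodule Φ N,
        QDiff.slopes ρ (QDiff.quotOp Φ N hN) = QDiff.slopes ρ Φ \ {μ} := by
  have hr := QDiff.isNewtonFunction_newtonFunction ρ hμ
  obtain ⟨N, hN, hrank, hsub, hquot⟩ := QDiff.exists_slope_submodule ρ hq hr μ
    fun hb ν hν => (hmax hb).2 hν
  refine ⟨N, ⟨⟨hN, ?_⟩, ?_⟩, hrank, hN, ?_⟩
  · ext ν
    rw [QDiff.slopes, hsub.newtonFunction_eq, Set.mem_ofPred_eq, Set.mem_singleton_iff]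
    refine ⟨fun h => by_contra fun h' => h (if_neg h'), ?_⟩
    rintro rfl
    simpa [QDiff.slopes] using hμ
  · rintro N' ⟨hN', hpure⟩
    -- Purity provides a slope, so the Newton function of `N'` is not the default value.
    have hμ' : μ ∈ QDiff.slopes ρ (QDiff.subOp Φ N' hN') := hpure ▸ rfl
    refine QDiff.le_of_slopes_disjoint ρ hN hN' hquot
      (QDiff.isNewtonFunction_newtonFunction ρ hμ') fun ν => ?_
    by_cases hν : ν = μ
    · exact Or.inl (if_pos hν)
    · right
      by_contra h
      exact hν (hpure ▸ (show ν ∈ QDiff.slopes ρ (QDiff.subOp Φ N' hN') from h) : ν ∈ ({μ} : Set ℚ))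
  · ext ν
    rw [QDiff.slopes, hquot.newtonFunction_eq, Set.mem_ofPred_eq, Set.mem_sdiff,
      Set.mem_singleton_iff]
    by_cases hν : ν = μ
    · simp [hν]
    · simp only [if_neg hν]
      exact ⟨fun h => ⟨h, hν⟩, fun h => h.1⟩
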